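/- **Setting.** Let $\mathcal H$ be a finite class of measurable binary classifiers on a data space $\mathcal X$ with data distribution $\mathcal D$, let $\pi$ be a prior (a probability measure on $\mathcal H$) and $h^*\in\mathcal H$ a target with $\pi(h^*)>0$. Let $d(h,h')=\Pr_{x\sim\mathcal D}(h(x)\ne h'(x))$. For $V\subseteq\mathcal H$ with $\pi(V)>0$ let $\pi|_V$ be $\pi$ conditioned on $V$ and $\Phi(V)=\mathbb E_{h,h'\sim\pi|_V}[d(h,h')]$ ($h,h'$ independent); put $\Phi(V)=0$ if $\pi(V)=0$. For $x\in\mathcal X$ let $V_x^+=\{h\in V: h(x)=1\}$ and $V_x^-=V\setminus V_x^+$. For $\pi(V)>0$, the point $x$ *$\rho$-average splits* $V$ if $$\max\Big\{\tfrac{\pi(V_x^+)^2}{\pi(V)^2}\Phi(V_x^+),\ \tfrac{\pi(V_x^-)^2}{\pi(V)^2}\Phi(V_x^-)\Big\}\le(1-\rho)\,\Phi(V),$$ and $\mathcal H$ has *average splitting index* $(\rho,\epsilon,\tau)$ if $\Pr_{x\sim\mathcal D}(x\ \rho\text{-average splits }V)\ge\tau$ for every $V\subseteq\mathcal H$ with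 $\Phi(V)>\epsilon$. For a finite sequence $E$ of pairs of hypotheses, $\psi(E)$ is the sum of $d(h,h')$ over the pairs $(h,h')$ in $E$, and $E_x^+$ (resp. $E_x^-$) is the subsequence of the pairs both of whose members label $x$ positively (resp. negatively). **Algorithm.** DBAL with accuracy $\epsilon$ and positive integer sample sizes $m$, $n_0$, $(m_t)_{t\ge1}$, $(n_t)_{t\ge1}$ starts with $V=\mathcal H$ and repeats the following rounds. It draws $n_0$ independent pairs $E$ from $(\pi|_V)^2$; if $\frac1{n_0}\psi(E)<\frac{3\epsilon}4$ it stops and returns $V$. Otherwise it draws $m$ independent points $x_1,\dots,x_m$ from $\mathcal D$, calls SELECT to choose one point $x_i$, queries the label $h^*(x_i)$, and replaces $V$ by $\{h\in V: h(x_i)=h^*(x_i)\}$. SELECT goes through $t=1,2,\dots$ with $\hat\rho_t=2^{-t}$: it draws $m_t$ independent pairs $E'$ from $(\pi|_V)^2$, puts $\hat\Phi_t=\frac1{m_t}\psi(E')$, draws $n_t$ further independent pairs $E$ from $(\pi|_V)^2$ ($n_t$ may depend on $\hat\Phi_t$), and if some $x_i$ has $\frac1{n_t}\max\{\psi(E_{x_i}^+),\psi(E_{x_i}^-)\}\le(1-\hat\rho_t)\hat\Phi_t$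 it halts and returns such an $x_i$ (ties are broken by an arbitrary fixed rule); otherwise it continues with $t+1$. All draws are fresh and independent. **Theorem.** There is an absolute constant $C>0$ such that for all $\rho,\tau\in(0,1]$, $\epsilon,\delta\in(0,1)$ and $p\in(0,1]$ there are an integer $K\ge0$ and sample sizes $m,n_0,(m_t),(n_t)$, depending only on $\rho,\epsilon,\tau,\delta,p$, with $$K\le\frac8\rho\Big(\log\frac2\epsilon+2\log\frac1p\Big),\qquad m\le\frac1\tau\log\frac{2K}\delta,$$ for which the following holds. For all $\mathcal X,\mathcal D,\mathcal H,\pi,h^*$ as above with $\pi(h^*)=p$ such that $\mathcal H$ has average splitting index $(\rho,\epsilon/2,\tau)$, and for every tie-breaking rule, with probability at least $1-\delta$ DBAL stops after at most $K$ label queries (one per round, with $m$ unlabeled points drawn per round), returns a version space $V$ with $\Phi(V)\le\epsilon$, and samples in each of its rounds (the last termination test included) at most $$C\Big(\frac1{\epsilon\rho^2}+\frac{\log(1/\rho)}{\epsilon^2}\Big)\Big(\log\frac{mK}\delta+\log^+\log\frac1\epsilon\Big)$$ hypotheses. Here $\log$ is the natural logarithm and $\log^+=\max(\log,0)$. -/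

import Mathlib

open MeasureTheory ProbabilityTheory

noncomputable section

namespace DBAL

variable {X H : Type*} [MeasurableSpace X] [MeasurableSpace H]

/-! A hypothesis class is a family `f : H → X → Bool` of binary classifiers, `D` is the data
distribution on `X`, and `prior` is the prior distribution on the class. -/

/-- The hypothesis distance `d(h, h') = Pr_{x ∼ D} (h x ≠ h' x)`. -/
def hdist (D : Measure X) (f : H → X → Bool) (h h' : H) : ℝ :=
  D.real {x | f h x ≠ f h' x}

/-- `V_x^+`: the hypotheses of `V` that label `x` positively. -/
def posPart (f : H → X → Bool) (V : Set H) (x : X) : Set H := {h ∈ V | f h x = true}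

/-- `V_x^- = V \ V_x^+`. -/
def negPart (f : H → X → Bool) (V : Set H) (x : X) : Set H := V \ posPart f V x

/-- The average diameter `Φ(V) = E_{h, h' ∼ prior|_V} [d(h, h')]`. If `prior V = 0` then
`prior[|V]` is the zero measure and the value is `0`. -/
def avgDiam (D : Measure X) (f : H → X → Bool) (prior : Measure H) (V : Set H) : ℝ :=
  ∫ h, ∫ h', hdist D f h h' ∂prior[|V] ∂prior[|V]

/-- The data point `x` `ρ`-average splits `V`. -/
def AvgSplits (D : Measure X) (f : H → X → Bool) (prior : Measure H) (ρ : ℝ) (V : Set H)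
    (x : X) : Prop :=
  max (prior.real (posPart f V x) ^ 2 / prior.real V ^ 2 * avgDiam D f prior (posPart f V x))
      (prior.real (negPart f V x) ^ 2 / prior.real V ^ 2 * avgDiam D f prior (negPart f V x))
    ≤ (1 - ρ) * avgDiam D f prior V

/-- The set `S` of hypotheses has average splitting index `(ρ, ε, τ)`. -/
def HasAvgSplittingIndex (D : Measure X) (f : H → X → Bool) (prior : Measure H) (S : Set H)
    (ρ ε τ : ℝ) : Prop :=
  ∀ V ⊆ S, ε < avgDiam D f prior V → τ ≤ D.real {x | AvgSplits D f prior ρ V x}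

/-- `ψ(E)` for the edge sequence `E` consisting of the first `N` pairs of `e`. -/
def psi (D : Measure X) (f : H → X → Bool) (N : ℕ) (e : ℕ → H × H) : ℝ :=
  ∑ i ∈ Finset.range N, hdist D f (e i).1 (e i).2

/-- `ψ(E_x^+)` (for `b = true`) and `ψ(E_x^-)` (for `b = false`), where `E` consists of the
first `N` pairs of `e`: only the pairs both of whose members label `x` by `b` are counted. -/
def psiAt (D : Measure X) (f : H → X → Bool) (N : ℕ) (e : ℕ → H × H) (x : X) (b : Bool) : ℝ :=
  ∑ i ∈ Finset.range N,
    if f (e i).1 x = b ∧ f (e i).2 x = b then hdist D f (e i).1 (e i).2 else 0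

/-- The sample sizes with which DBAL and its subroutine SELECT are run. The rounds `t` of SELECT
are counted from `0` here. -/
structure SampleSizes where
  /-- number of unlabeled points drawn in each round -/
  m : ℕ
  /-- number of pairs of hypotheses drawn for each evaluation of the termination condition -/
  n : ℕ
  /-- number of pairs in `E'` in round `t` of SELECT -/
  est : ℕ → ℕ
  /-- number of pairs in `E` in round `t` of SELECT; it may depend on the estimate of `Φ(V)`
  that was computed from `E'` -/
  test : ℕ → ℝ → ℕ
  m_pos : 0 < m
  n_pos : 0 < n
  est_pos : ∀ t, 0 < est t
  test_pos : ∀ t a, 0 < test t a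

/-- The places of one round of DBAL where hypotheses are sampled: the termination condition, and
the draws of `E'` and of `E` in round `t` of SELECT. -/
inductive Stage : Type
  | check : Stage
  | est (t : ℕ) : Stage
  | test (t : ℕ) : Stage

/-- The randomness that is available in one round of DBAL: the `m` unlabeled points, and for each
stage an infinite stream of samples, of which the algorithm reads as many as it needs. The `i`-th
entry of a stream holds, for each `V`, the pair of hypotheses that is obtained if the
algorithm asks for a pair from `(prior|_V)²`. -/
abbrev RoundTape (m : ℕ) (X H : Type*) : Type _ :=
  (Fin m → X) × (Stage → ℕ → Set H → H × H)

open Classical in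
/-- The distribution `prior|_V` (and, as an irrelevant default, `prior` if `V` has mass `0`). -/
def sampler (prior : Measure H) (V : Set H) : Measure H :=
  if prior V = 0 then prior else prior[|V]

instance (prior : Measure H) [IsProbabilityMeasure prior] (V : Set H) :
    IsProbabilityMeasure (sampler prior V) := by
  unfold sampler
  split_ifs with h
  · infer_instance
  · exact cond_isProbabilityMeasure h

/-- The law of the randomness of one round: the points are i.i.d. from `D`, all pairs are
independent of each other and of the points, and the pairs for `V` have law `(prior|_V)²`. -/
def roundLaw (m : ℕ) (D : Measure X) [IsProbabilityMeasure D] (prior : Measure H)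
    [IsProbabilityMeasure prior] : Measure (RoundTape m X H) :=
  (Measure.pi fun _ : Fin m => D).prod
    (Measure.infinitePi fun _ : Stage => Measure.infinitePi fun _ : ℕ =>
      Measure.infinitePi fun V : Set H => (sampler prior V).prod (sampler prior V))

instance (m : ℕ) (D : Measure X) [IsProbabilityMeasure D] (prior : Measure H)
    [IsProbabilityMeasure prior] : IsProbabilityMeasure (roundLaw m D prior) := by
  unfold roundLaw; infer_instance

/-- The law of the whole randomness of DBAL: every round uses fresh independent samples. -/
def law (m : ℕ) (D : Measure X) [IsProbabilityMeasure D] (prior : Measure H)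
    [IsProbabilityMeasure prior] : Measure (ℕ → RoundTape m X H) :=
  Measure.infinitePi fun _ : ℕ => roundLaw m D prior

section Select

variable (D : Measure X) (f : H → X → Bool) (s : SampleSizes) (V : Set H)
  (r : RoundTape s.m X H)

/-- The stream of pairs from `(prior|_V)²` that is read at the stage `g`. -/
def draws (g : Stage) : ℕ → H × H := fun i => r.2 g i V

/-- The estimate `Φ̂_t` of `Φ(V)` in round `t` of SELECT. -/
def phiHat (t : ℕ) : ℝ := psi D f (s.est t) (draws s V r (.est t)) / s.est t

/-- The number of pairs in `E` in round `t` of SELECT. -/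
def testSize (t : ℕ) : ℕ := s.test t (phiHat D f s V r t)

/-- The points `x_i` that satisfy the halting condition of SELECT in round `t`, where
`ρ̂_t = 1/2, 1/4, 1/8, …` for `t = 0, 1, 2, …`. -/
def candidates (t : ℕ) : Set (Fin s.m) :=
  {i | max (psiAt D f (testSize D f s V r t) (draws s V r (.test t)) (r.1 i) true)
        (psiAt D f (testSize D f s V r t) (draws s V r (.test t)) (r.1 i) false)
        / testSize D f s V r t
      ≤ (1 - (1 / 2) ^ (t + 1)) * phiHat D f s V r t}

open Classical in
/-- The round in which SELECT halts: the first one that has a candidate; `none` if there is no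
such round, in which case SELECT runs forever. -/
def selectRound : Option ℕ :=
  if h : ∃ t, (candidates D f s V r t).Nonempty then some (Nat.find h) else none

/-- The index of the point that SELECT returns. The rule `tie` says which of the
candidates is taken. -/
def select (tie : Set (Fin s.m) → Fin s.m) : Option (Fin s.m) :=
  (selectRound D f s V r).map fun t => tie (candidates D f s V r t)

/-- The number of hypotheses that SELECT samples (irrelevant default `0` if it never halts). -/
def selectCost : ℕ :=
  match selectRound D f s V r with
  | some T => ∑ t ∈ Finset.range (T + 1), 2 * (s.est t + testSize D f s V r t)
  | none => 0

/-- The condition of the while loop of DBAL: `(1/n) ψ(E) ≥ 3ε/4`. -/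
def Continues (ε : ℝ) : Prop :=
  3 * ε / 4 ≤ psi D f s.n (draws s V r .check) / s.n

open Classical in
/-- The number of hypotheses that DBAL samples in a round that starts with version space `V`. -/
def roundCost (ε : ℝ) : ℕ :=
  2 * s.n + if Continues D f s V r ε then selectCost D f s V r else 0

end Select

open Classical in
/-- The run of DBAL with target `hstar` on the random input `ω`: the value at `k` is `some V` if
DBAL evaluates its termination condition for the `k`-th time (counted from `0`), so after exactly
`k` label queries, with version space `V`. It is `none` if DBAL returned, or got stuck in
SELECT, before that. -/
def run (D : Measure X) (f : H → X → Bool) (s : SampleSizes) (tie : Set (Fin s.m) → Fin s.m)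
    (ε : ℝ) (hstar : H) (ω : ℕ → RoundTape s.m X H) : ℕ → Option (Set H)
  | 0 => some Set.univ
  | k + 1 =>
    (run D f s tie ε hstar ω k).bind fun V =>
      if Continues D f s V (ω k) ε then
        (select D f s V (ω k) tie).map fun i =>
          {h ∈ V | f h ((ω k).1 i) = f hstar ((ω k).1 i)}
      else none

/-- DBAL returns the version space `V` after exactly `k` label queries. -/
def Returns (D : Measure X) (f : H → X → Bool) (s : SampleSizes)
    (tie : Set (Fin s.m) → Fin s.m) (ε : ℝ) (hstar : H) (ω : ℕ → RoundTape s.m X H) (k : ℕ)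
    (V : Set H) : Prop :=
  run D f s tie ε hstar ω k = some V ∧ ¬ Continues D f s V (ω k) ε

end DBAL

end

noncomputable section

namespace DBAL

set_option linter.unusedSectionVars false

/-! ### Concentration and adaptivity -/

section Concentration

/-! The potential is the unnormalised diameter `pairMass`, π(V)²Φ(V). It is at most 1 for the full
class. The normalised quantities compared in an average split are the potentials of the two label
parts divided by π(V)², so a query that splits V well contracts the potential whichever label is
returned. The target stays in V, hence π(V) ≥ p, and Φ(V) > ε/2 forces the potential above p²ε/2.
Contraction by 1 - 3ρ/16 per query therefore leaves room for about (16/(3ρ)) log(2/(p²ε)) queries,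
and the factor 8/ρ in K leaves slack for rounding.

One round is controlled for a fixed V by Chernoff bounds whose error is relative to Φ(V), not
absolute. The termination test separates Φ ≤ ε/2 from Φ > ε (`measureReal_badCheck_le`). If Φ(V) >
ε/2, then with high probability some sampled point splits V, and the estimates of SELECT in its
first T+1 rounds are accurate to ρ̂_t/8 relative to Φ(V) (`measureReal_badSelect_le`). Such
estimates force SELECT to halt with a (3ρ/16)-split (`exists_selectRound_of_goodEstimates`).

V is random, but it is determined by earlier rounds and so independent of the current tape.
Averaging over its values costs no factor for the number of version spaces (`measure_adaptive_le`,
`measurableSet_run`). A union bound over at most K+1 tests and K calls of SELECT (`law_not_le`)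
reduces the theorem to a deterministic statement about good inputs (`exists_returns`).

Relative accuracy 2^{-t} costs 4^t/ε samples, and the sum up to 2^T ≤ 2/ρ is of order 1/(ερ²). The
remaining terms of the cost bound are nonnegative and not needed. -/

lemma abs_sum_le_of_mem_unit {S : Type*} {Z : S → ℝ} (h0 : ∀ x, 0 ≤ Z x)
    (h1 : ∀ x, Z x ≤ 1) (n : ℕ) (e : ℕ → S) :
    |∑ i ∈ Finset.range n, Z (e i)| ≤ n := by
  rw [abs_of_nonneg (Finset.sum_nonneg fun i _ => h0 _)]
  exact (Finset.sum_le_sum fun i _ => h1 (e i)).trans (by simp)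

variable {S : Type*} [MeasurableSpace S] (ν : Measure S) [IsProbabilityMeasure ν]
  {Z : S → ℝ}

/-- From e^u ≤ 1 + u + u² and z² ≤ z. Keeping the right side linear in z makes the moment bound
depend on the mean alone, which yields relative rather than absolute deviations. -/
lemma exp_mul_le_of_mem_unit {s z : ℝ} (hs : |s| ≤ 1) (h0 : 0 ≤ z) (h1 : z ≤ 1) :
    Real.exp (s * z) ≤ 1 + z * (s + s ^ 2) := by
  have h : |s * z| ≤ 1 := by
    rw [abs_mul, abs_of_nonneg h0]
    exact mul_le_one₀ hs h0 h1
  have h2 := (abs_le.1 (Real.abs_exp_sub_one_sub_id_le h)).2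
  nlinarith [mul_nonneg (sq_nonneg s) (mul_nonneg h0 (sub_nonneg.2 h1))]

lemma integrable_of_mem_unit (hZ : Measurable Z) (h0 : ∀ x, 0 ≤ Z x) (h1 : ∀ x, Z x ≤ 1) :
    Integrable Z ν :=
  Integrable.of_bound hZ.aestronglyMeasurable 1 <| .of_forall fun x => by
    rw [Real.norm_of_nonneg (h0 x)]; exact h1 x

lemma integrable_exp_of_abs_le (hZ : Measurable Z) {c : ℝ} (h : ∀ x, |Z x| ≤ c) (s : ℝ) :
    Integrable (fun x => Real.exp (s * Z x)) ν :=
  Integrable.of_bound (by fun_prop) (Real.exp (|s| * c)) <| .of_forall fun x => by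
    rw [Real.norm_of_nonneg (Real.exp_pos _).le]
    refine Real.exp_le_exp.2 ((le_abs_self _).trans ?_)
    rw [abs_mul]
    exact mul_le_mul_of_nonneg_left (h x) (abs_nonneg _)

lemma mgf_le_of_mem_unit (hZ : Measurable Z) (h0 : ∀ x, 0 ≤ Z x) (h1 : ∀ x, Z x ≤ 1)
    {s : ℝ} (hs : |s| ≤ 1) : mgf Z ν s ≤ Real.exp ((∫ x, Z x ∂ν) * (s + s ^ 2)) := by
  have hi := integrable_of_mem_unit ν hZ h0 h1
  calc mgf Z ν s ≤ ∫ x, 1 + Z x * (s + s ^ 2) ∂ν :=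
        integral_mono (integrable_exp_of_abs_le ν hZ
            (fun x => (abs_of_nonneg (h0 x)).trans_le (h1 x)) s)
          ((integrable_const _).add (hi.mul_const _))
          fun x => exp_mul_le_of_mem_unit hs (h0 x) (h1 x)
    _ = 1 + (∫ x, Z x ∂ν) * (s + s ^ 2) := by
        rw [integral_add (integrable_const _) (hi.mul_const _), integral_mul_const]; simp
    _ ≤ _ := by linarith [Real.add_one_le_exp ((∫ x, Z x ∂ν) * (s + s ^ 2))]

lemma mgf_sum_le_of_mem_unit (hZ : Measurable Z) (h0 : ∀ x, 0 ≤ Z x) (h1 : ∀ x, Z x ≤ 1)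
    {s : ℝ} (hs : |s| ≤ 1) (n : ℕ) :
    mgf (fun e : ℕ → S => ∑ i ∈ Finset.range n, Z (e i)) (Measure.infinitePi fun _ : ℕ => ν) s
      ≤ Real.exp (n * ((∫ x, Z x ∂ν) * (s + s ^ 2))) := by
  have hind : iIndepFun (fun (i : ℕ) (e : ℕ → S) => Z (e i))
      (Measure.infinitePi fun _ : ℕ => ν) :=
    iIndepFun_infinitePi (P := fun _ : ℕ => ν) (X := fun _ => Z) (fun _ => hZ)
  have h := hind.mgf_sum (t := s) (fun i => by fun_prop) (Finset.range n)
  have hsum : (∑ i ∈ Finset.range n, fun e : ℕ → S => Z (e i))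
      = fun e : ℕ → S => ∑ i ∈ Finset.range n, Z (e i) := by ext e; simp
  have hi : ∀ i : ℕ, mgf (fun e : ℕ → S => Z (e i)) (Measure.infinitePi fun _ : ℕ => ν) s
      = mgf Z ν s := fun i => by
    have hmap := Measure.infinitePi_map_eval (fun _ : ℕ => ν) i
    simp only [mgf]
    conv_rhs => rw [← hmap]
    rw [integral_map (measurable_pi_apply i).aemeasurable (by fun_prop)]
  rw [← hsum, h, Finset.prod_congr rfl fun i _ => hi i, Finset.prod_const, Finset.card_range,
    Real.exp_nat_mul]
  exact pow_le_pow_left₀ mgf_nonneg (mgf_le_of_mem_unit ν hZ h0 h1 hs) n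

/-- Upper tail of an average of i.i.d. variables with values in `[0, 1]` and mean at most `φ`. -/
lemma measureReal_sum_ge_le (hZ : Measurable Z) (h0 : ∀ x, 0 ≤ Z x) (h1 : ∀ x, Z x ≤ 1)
    {φ η : ℝ} (hφ : ∫ x, Z x ∂ν ≤ φ) (hη : 0 ≤ η) (hη1 : η ≤ 1) (n : ℕ) :
    (Measure.infinitePi fun _ : ℕ => ν).real
      {e | n * (∫ x, Z x ∂ν + η * φ) ≤ ∑ i ∈ Finset.range n, Z (e i)}
      ≤ Real.exp (-(n * φ * η ^ 2 / 4)) := by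
  set a := ∫ x, Z x ∂ν
  -- The value s = η/2 minimises φ(s² - ηs), the exponent per sample once the mean is replaced by φ.
  -- Allowing φ to exceed the mean matters later: the pairs agreeing at x may have a tiny mean, yet
  -- their error is measured against Φ(V).
  have hs : |η / 2| ≤ 1 := by rw [abs_of_nonneg (by linarith)]; linarith
  refine (measure_ge_le_exp_mul_mgf (t := η / 2) _ (by linarith)
    (integrable_exp_of_abs_le _ (by fun_prop) (abs_sum_le_of_mem_unit h0 h1 n) _)).trans ?_
  refine (mul_le_mul_of_nonneg_left (mgf_sum_le_of_mem_unit ν hZ h0 h1 hs n)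
    (Real.exp_pos _).le).trans ?_
  rw [← Real.exp_add, Real.exp_le_exp]
  have : (n : ℝ) * η ^ 2 * a ≤ n * η ^ 2 * φ := by gcongr
  nlinarith

/-- Lower tail of an average of i.i.d. variables with values in `[0, 1]` and mean at most `φ`. -/
lemma measureReal_sum_le_le (hZ : Measurable Z) (h0 : ∀ x, 0 ≤ Z x) (h1 : ∀ x, Z x ≤ 1)
    {φ η : ℝ} (hφ : ∫ x, Z x ∂ν ≤ φ) (hη : 0 ≤ η) (hη1 : η ≤ 1) (n : ℕ) :
    (Measure.infinitePi fun _ : ℕ => ν).real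
      {e | ∑ i ∈ Finset.range n, Z (e i) ≤ n * (∫ x, Z x ∂ν - η * φ)}
      ≤ Real.exp (-(n * φ * η ^ 2 / 4)) := by
  set a := ∫ x, Z x ∂ν
  have hs : |-(η / 2)| ≤ 1 := by rw [abs_neg, abs_of_nonneg (by linarith)]; linarith
  refine (measure_le_le_exp_mul_mgf (t := -(η / 2)) _ (by linarith)
    (integrable_exp_of_abs_le _ (by fun_prop) (abs_sum_le_of_mem_unit h0 h1 n) _)).trans ?_
  refine (mul_le_mul_of_nonneg_left (mgf_sum_le_of_mem_unit ν hZ h0 h1 hs n)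
    (Real.exp_pos _).le).trans ?_
  rw [← Real.exp_add, Real.exp_le_exp]
  have : (n : ℝ) * η ^ 2 * a ≤ n * η ^ 2 * φ := by gcongr
  nlinarith

/-- Two-sided tail of an average of i.i.d. variables with values in `[0, 1]` and mean at most
`φ`. -/
lemma measureReal_lt_abs_mean_sub_le (hZ : Measurable Z) (h0 : ∀ x, 0 ≤ Z x) (h1 : ∀ x, Z x ≤ 1)
    {φ η : ℝ} (hφ : ∫ x, Z x ∂ν ≤ φ) (hη : 0 ≤ η) (hη1 : η ≤ 1) {n : ℕ} (hn : 0 < n) :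
    (Measure.infinitePi fun _ : ℕ => ν).real
      {e | η * φ < |(∑ i ∈ Finset.range n, Z (e i)) / n - ∫ x, Z x ∂ν|}
      ≤ 2 * Real.exp (-(n * φ * η ^ 2 / 4)) := by
  have hn' : (0 : ℝ) < n := by exact_mod_cast hn
  refine (measureReal_mono (s₂ := {e | n * (∫ x, Z x ∂ν + η * φ) ≤ ∑ i ∈ Finset.range n, Z (e i)} ∪
    {e | ∑ i ∈ Finset.range n, Z (e i) ≤ n * (∫ x, Z x ∂ν - η * φ)}) ?_).trans ?_
  · intro e he
    rw [Set.mem_ofPred_eq, lt_abs] at he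
    rcases he with h | h
    · left
      have : ∫ x, Z x ∂ν + η * φ < (∑ i ∈ Finset.range n, Z (e i)) / n := by linarith
      rw [lt_div_iff₀' hn'] at this
      exact this.le
    · right
      have : (∑ i ∈ Finset.range n, Z (e i)) / n < ∫ x, Z x ∂ν - η * φ := by linarith
      rw [div_lt_iff₀' hn'] at this
      exact this.le
  · refine (measureReal_union_le _ _).trans ?_
    linarith [measureReal_sum_ge_le ν hZ h0 h1 hφ hη hη1 n,
      measureReal_sum_le_le ν hZ h0 h1 hφ hη hη1 n]

end Concentration

/-! ### Bad events at a state chosen by the past. -/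

section Adaptive

variable {R : Type*} [MeasurableSpace R] (l : Measure R) [IsProbabilityMeasure l]

/-- The σ-algebra generated by the first `k` coordinates of a sequence. -/
@[reducible]
def past (R : Type*) [MeasurableSpace R] (k : ℕ) : MeasurableSpace (ℕ → R) :=
  ⨆ j ∈ Set.Iio k, MeasurableSpace.comap (fun ω : ℕ → R => ω j) inferInstance

lemma past_mono {j k : ℕ} (h : j ≤ k) : past R j ≤ past R k :=
  biSup_mono fun _ hi => lt_of_lt_of_le hi h

lemma comap_eval_le_past {j k : ℕ} (h : j < k) :
    MeasurableSpace.comap (fun ω : ℕ → R => ω j) inferInstance ≤ past R k :=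
  le_biSup (fun j => MeasurableSpace.comap (fun ω : ℕ → R => ω j) inferInstance) h

lemma past_le (k : ℕ) : past R k ≤ MeasurableSpace.pi :=
  iSup₂_le fun j _ => (measurable_pi_apply j).comap_le

/-- Independence of coordinate k from the earlier ones. Passing to a measurable hull of B gives an
inequality that needs no measurability of B, so the bad events of a round need not be shown
measurable. -/
lemma measure_inter_past_le {k : ℕ} {A : Set (ℕ → R)} (hA : MeasurableSet[past R k] A)
    (B : Set R) :
    (Measure.infinitePi fun _ : ℕ => l) (A ∩ {ω | ω k ∈ B})
      ≤ (Measure.infinitePi fun _ : ℕ => l) A * l B := by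
  have hind : iIndepFun (fun (i : ℕ) (ω : ℕ → R) => ω i) (Measure.infinitePi fun _ : ℕ => l) :=
    iIndepFun_infinitePi (P := fun _ : ℕ => l) (X := fun _ => id) (fun _ => measurable_id)
  have h := indep_iSup_of_disjoint (fun i => (measurable_pi_apply i).comap_le) hind
    (S := Set.Iio k) (T := {k}) (by simp)
  rw [Indep_iff] at h
  have hB : MeasurableSet[⨆ i ∈ ({k} : Set ℕ),
      MeasurableSpace.comap (fun ω : ℕ → R => ω i) inferInstance]
      ((fun ω : ℕ → R => ω k) ⁻¹' toMeasurable l B) := by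
    rw [iSup_singleton]
    exact ⟨_, measurableSet_toMeasurable l B, rfl⟩
  calc _ ≤ (Measure.infinitePi fun _ : ℕ => l)
          (A ∩ (fun ω : ℕ → R => ω k) ⁻¹' toMeasurable l B) :=
        measure_mono (Set.inter_subset_inter_right _ fun ω hω => subset_toMeasurable l B hω)
    _ = _ := h _ _ hA hB
    _ = _ := by
      rw [← Measure.map_apply (measurable_pi_apply k) (measurableSet_toMeasurable l B),
        Measure.infinitePi_map_eval, measure_toMeasurable]

/-- A union bound for a state that depends on the past only and a bad event for the present
whose probability is at most `β` for each value of the state. -/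
lemma measure_adaptive_le {S : Type*} [Finite S] {k : ℕ} {W : (ℕ → R) → Option S}
    (hW : ∀ s, MeasurableSet[past R k] {ω | W ω = some s}) {bad : S → Set R} {β : ENNReal}
    (hbad : ∀ s, l (bad s) ≤ β) :
    (Measure.infinitePi fun _ : ℕ => l) {ω | ∃ s, W ω = some s ∧ ω k ∈ bad s} ≤ β := by
  have := Fintype.ofFinite S
  have hsub : {ω | ∃ s, W ω = some s ∧ ω k ∈ bad s}
      = ⋃ s, {ω | W ω = some s} ∩ {ω | ω k ∈ bad s} := by ext; simp
  rw [hsub]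
  calc _ ≤ ∑ s, (Measure.infinitePi fun _ : ℕ => l) ({ω | W ω = some s} ∩ {ω | ω k ∈ bad s}) :=
        measure_iUnion_fintype_le _ _
    _ ≤ ∑ s, (Measure.infinitePi fun _ : ℕ => l) {ω | W ω = some s} * β :=
        Finset.sum_le_sum fun s _ => (measure_inter_past_le l (hW s) _).trans
          (mul_le_mul_right (hbad s) _)
    -- The events W = s are disjoint, so their weights sum to at most 1 and the number of states
    -- does not enter.
    _ = (Measure.infinitePi fun _ : ℕ => l) (⋃ s, {ω | W ω = some s}) * β := by
        rw [← Finset.sum_mul, measure_iUnion (fun s t hst => ?_) fun s => past_le k _ (hW s),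
          tsum_fintype]
        refine Set.disjoint_left.2 fun ω h1 h2 => hst ?_
        exact Option.some_injective _ (h1.symm.trans h2)
    _ ≤ 1 * β := mul_le_mul_left prob_le_one _
    _ = β := one_mul _

end Adaptive

/-! ### The unnormalised average diameter -/

section PairMass

variable {X H : Type*} [MeasurableSpace X] [MeasurableSpace H]
  (D : Measure X) (f : H → X → Bool) (prior : Measure H)

/-- The unnormalised average diameter `prior(V)² Φ(V)`. -/
def pairMass (V : Set H) : ℝ := ∫ h in V, ∫ h' in V, hdist D f h h' ∂prior ∂prior

/-- The hypotheses of `V` that label `x` by `b`. -/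
def labelPart (f : H → X → Bool) (V : Set H) (x : X) (b : Bool) : Set H := {h ∈ V | f h x = b}

/-- The distance of a pair of hypotheses, counted only if both of them label `x` by `b`. -/
def agreeDist (x : X) (b : Bool) (e : H × H) : ℝ :=
  if f e.1 x = b ∧ f e.2 x = b then hdist D f e.1 e.2 else 0

/-- The law of a pair of hypotheses that is sampled from `V`. -/
abbrev pairLaw (V : Set H) : Measure (H × H) := (sampler prior V).prod (sampler prior V)

lemma negPart_eq (V : Set H) (x : X) : negPart f V x = labelPart f V x false := by
  ext h; simp only [negPart, posPart, labelPart, Set.mem_sdiff, Set.mem_ofPred_eq]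
  cases f h x <;> simp

lemma hdist_nonneg (h h' : H) : 0 ≤ hdist D f h h' := measureReal_nonneg

lemma hdist_le_one [IsProbabilityMeasure D] (h h' : H) : hdist D f h h' ≤ 1 := measureReal_le_one

lemma agreeDist_nonneg (x : X) (b : Bool) (e : H × H) : 0 ≤ agreeDist D f x b e := by
  unfold agreeDist; split_ifs <;> simp [hdist_nonneg]

lemma agreeDist_le_hdist (x : X) (b : Bool) (e : H × H) :
    agreeDist D f x b e ≤ hdist D f e.1 e.2 := by
  unfold agreeDist; split_ifs <;> simp [hdist_nonneg]

lemma agreeDist_le_one [IsProbabilityMeasure D] (x : X) (b : Bool) (e : H × H) :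
    agreeDist D f x b e ≤ 1 := (agreeDist_le_hdist D f x b e).trans (hdist_le_one D f _ _)

lemma pairMass_nonneg (V : Set H) : 0 ≤ pairMass D f prior V :=
  integral_nonneg fun _ => integral_nonneg fun _ => hdist_nonneg D f _ _

lemma integral_cond (V : Set H) (g : H → ℝ) :
    ∫ h, g h ∂prior[|V] = (prior.real V)⁻¹ * ∫ h in V, g h ∂prior := by
  rw [ProbabilityTheory.cond, integral_smul_measure, ENNReal.toReal_inv]; rfl

lemma avgDiam_eq (V : Set H) :
    avgDiam D f prior V = pairMass D f prior V / prior.real V ^ 2 := by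
  simp only [avgDiam, pairMass, integral_cond, integral_const_mul]
  field_simp

lemma avgDiam_nonneg (V : Set H) : 0 ≤ avgDiam D f prior V := by
  rw [avgDiam_eq]; exact div_nonneg (pairMass_nonneg D f prior V) (sq_nonneg _)

/-- For a null V both sides vanish, so the potential can replace normalised diameters without case
distinctions, also for label parts of mass zero. -/
lemma sq_mul_avgDiam [IsFiniteMeasure prior] (V : Set H) :
    prior.real V ^ 2 * avgDiam D f prior V = pairMass D f prior V := by
  by_cases h : prior.real V = 0
  · have h' : prior V = 0 := by simpa [measureReal_def, ENNReal.toReal_eq_zero_iff] using h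
    simp [h, pairMass, Measure.restrict_eq_zero.2 h']
  · rw [avgDiam_eq]; field_simp

lemma avgSplits_iff [IsFiniteMeasure prior] (ρ : ℝ) (V : Set H) (x : X) :
    AvgSplits D f prior ρ V x ↔ ∀ b, pairMass D f prior (labelPart f V x b) / prior.real V ^ 2
      ≤ (1 - ρ) * avgDiam D f prior V := by
  rw [AvgSplits, max_le_iff, Bool.forall_bool, negPart_eq, div_mul_eq_mul_div,
    div_mul_eq_mul_div, sq_mul_avgDiam, sq_mul_avgDiam, and_comm]
  rfl

variable [Finite H] [MeasurableSingletonClass H] [IsProbabilityMeasure prior]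

lemma integral_pairLaw {V : Set H} (hV : prior V ≠ 0) (g : H × H → ℝ) :
    ∫ e, g e ∂pairLaw prior V
      = (∫ h in V, ∫ h' in V, g (h, h') ∂prior ∂prior) / prior.real V ^ 2 := by
  have := Fintype.ofFinite H
  rw [pairLaw, integral_prod _ .of_finite, sampler, if_neg hV]
  simp only [integral_cond, integral_const_mul]
  field_simp

lemma integral_hdist_pairLaw {V : Set H} (hV : prior V ≠ 0) :
    ∫ e, hdist D f e.1 e.2 ∂pairLaw prior V = avgDiam D f prior V := by
  rw [integral_pairLaw prior hV, avgDiam_eq, pairMass]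

/-- Both members of a pair must lie in the label part, so both integrals restrict to it. This is why
ψ(E_x^±)/n estimates exactly the quantities in the definition of an average split. -/
lemma integral_agreeDist_pairLaw {V : Set H} (hV : prior V ≠ 0) (x : X) (b : Bool) :
    ∫ e, agreeDist D f x b e ∂pairLaw prior V
      = pairMass D f prior (labelPart f V x b) / prior.real V ^ 2 := by
  have := Fintype.ofFinite H
  rw [integral_pairLaw prior hV, pairMass]
  congr 1
  set A : Set H := {h | f h x = b}
  have hA : MeasurableSet A := .of_discrete
  have hVA : labelPart f V x b = V ∩ A := rfl
  rw [hVA, ← setIntegral_indicator hA]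
  refine integral_congr_ae (.of_forall fun h => ?_)
  by_cases hh : h ∈ A
  · rw [Set.indicator_of_mem hh]
    dsimp only
    rw [← setIntegral_indicator hA]
    refine integral_congr_ae (.of_forall fun h' => ?_)
    have hh2 : f h x = b := hh
    by_cases hh' : f h' x = b <;> simp [agreeDist, Set.indicator, A, hh2, hh']
  · have hh2 : ¬ f h x = b := hh
    simp [Set.indicator_of_notMem hh, agreeDist, hh2]

lemma integral_agreeDist_le {V : Set H} (hV : prior V ≠ 0) (x : X) (b : Bool) :
    ∫ e, agreeDist D f x b e ∂pairLaw prior V ≤ avgDiam D f prior V := by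
  have := Fintype.ofFinite H
  rw [← integral_hdist_pairLaw D f prior hV]
  exact integral_mono .of_finite .of_finite fun e => agreeDist_le_hdist D f x b e

lemma pairMass_univ_le_one [IsProbabilityMeasure D] : pairMass D f prior Set.univ ≤ 1 := by
  simp only [pairMass, Measure.restrict_univ]
  refine (integral_mono_of_nonneg (.of_forall fun _ => integral_nonneg fun _ =>
    hdist_nonneg D f _ _) (integrable_const (1 : ℝ)) (.of_forall fun h => ?_)).trans (by simp)
  exact (integral_mono_of_nonneg (.of_forall fun _ => hdist_nonneg D f _ _)
    (integrable_const (1 : ℝ)) (.of_forall fun h => hdist_le_one D f _ _)).trans (by simp)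

end PairMass

/-! ### Measurability -/

section Measurability

variable {X H : Type*} [MeasurableSpace X] [MeasurableSpace H] [Finite H]
  [MeasurableSingletonClass H] (D : Measure X) {f : H → X → Bool}

/-- A property of a point that depends only on its labels is measurable. -/
lemma measurableSet_labels (hf : ∀ h, Measurable (f h)) (P : (H → Bool) → Prop) :
    MeasurableSet {x | P fun h => f h x} :=
  (measurable_pi_lambda (fun x h => f h x) hf) (MeasurableSet.of_discrete (s := {l | P l}))

lemma measurableSet_avgSplits (hf : ∀ h, Measurable (f h))
    (prior : Measure H) (ρ : ℝ) (V : Set H) : MeasurableSet {x | AvgSplits D f prior ρ V x} :=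
  measurableSet_labels hf fun l =>
    max (prior.real {h ∈ V | l h = true} ^ 2 / prior.real V ^ 2 *
        avgDiam D f prior {h ∈ V | l h = true})
      (prior.real (V \ {h ∈ V | l h = true}) ^ 2 / prior.real V ^ 2 *
        avgDiam D f prior (V \ {h ∈ V | l h = true}))
    ≤ (1 - ρ) * avgDiam D f prior V

lemma measurable_agreeDist (hf : ∀ h, Measurable (f h)) (b : Bool) :
    Measurable fun q : X × (H × H) => agreeDist D f q.1 b q.2 := by
  have := Fintype.ofFinite H
  refine measurable_from_prod_countable_left fun e => ?_
  exact Measurable.ite (measurableSet_labels hf fun l => l e.1 = b ∧ l e.2 = b)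
    (measurable_const (a := hdist D f e.1 e.2)) measurable_const

lemma measurable_psiAt (hf : ∀ h, Measurable (f h)) (N : ℕ) (b : Bool) :
    Measurable fun q : X × (ℕ → H × H) => psiAt D f N q.2 q.1 b := by
  refine Finset.measurable_sum _ fun i _ => ?_
  exact (measurable_agreeDist D hf b).comp
    (measurable_fst.prodMk ((measurable_pi_apply i).comp measurable_snd))

lemma measurable_psi [Countable H] (N : ℕ) : Measurable fun e : ℕ → H × H => psi D f N e := by
  refine Finset.measurable_sum _ fun i _ => ?_
  exact (Measurable.of_discrete (f := fun q : H × H => hdist D f q.1 q.2)).comp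
    (measurable_pi_apply i)

variable (s : SampleSizes) (V : Set H)

lemma measurable_draws (g : Stage) :
    Measurable fun r : RoundTape s.m X H => draws s V r g :=
  measurable_pi_lambda _ fun i => (measurable_pi_apply V).comp
    ((measurable_pi_apply i).comp ((measurable_pi_apply g).comp measurable_snd))

lemma measurable_phiHat (t : ℕ) :
    Measurable fun r : RoundTape s.m X H => phiHat D f s V r t :=
  ((measurable_psi D _).comp (measurable_draws s V _)).div_const _

lemma measurableSet_continues (ε : ℝ) :
    MeasurableSet {r : RoundTape s.m X H | Continues D f s V r ε} :=
  measurableSet_le measurable_const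
    (((measurable_psi D _).comp (measurable_draws s V _)).div_const _)

variable {N : ℕ → ℕ} (hN : ∀ t a, s.test t a = N t)
include hN

lemma measurableSet_mem_candidates (hf : ∀ h, Measurable (f h)) (t : ℕ) (i : Fin s.m) :
    MeasurableSet {r : RoundTape s.m X H | i ∈ candidates D f s V r t} := by
  simp only [candidates, testSize, hN, Set.mem_ofPred_eq]
  have h : ∀ b, Measurable fun r : RoundTape s.m X H =>
      psiAt D f (N t) (draws s V r (.test t)) (r.1 i) b := fun b =>
    (measurable_psiAt D hf (N t) b).comp (((measurable_pi_apply i).comp measurable_fst).prodMk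
      (measurable_draws s V _))
  exact measurableSet_le (((h true).max (h false)).div_const _)
    ((measurable_phiHat D s V t).const_mul _)

lemma measurableSet_candidates_eq (hf : ∀ h, Measurable (f h)) (t : ℕ) (A : Set (Fin s.m)) :
    MeasurableSet {r : RoundTape s.m X H | candidates D f s V r t = A} := by
  have : {r : RoundTape s.m X H | candidates D f s V r t = A}
      = ⋂ i, {r | i ∈ candidates D f s V r t ↔ i ∈ A} := by
    ext r; simp [Set.ext_iff]
  rw [this]
  refine MeasurableSet.iInter fun i => ?_
  exact (measurableSet_mem_candidates D s V hN hf t i).iff (.const _)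

lemma measurableSet_selectRound (hf : ∀ h, Measurable (f h)) (t : ℕ) :
    MeasurableSet {r : RoundTape s.m X H | selectRound D f s V r = some t} := by
  classical
  have : {r : RoundTape s.m X H | selectRound D f s V r = some t}
      = {r | candidates D f s V r t = ∅}ᶜ ∩ ⋂ u, ⋂ (_ : u < t),
        {r | candidates D f s V r u = ∅} := by
    ext r
    simp only [selectRound, Set.mem_ofPred_eq, Set.mem_inter_iff, Set.mem_compl_iff,
      Set.mem_iInter, ← Set.nonempty_iff_ne_empty, ← Ne.eq_def]
    split_ifs with h
    · rw [Option.some_inj, Nat.find_eq_iff]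
      simp only [Set.not_nonempty_iff_eq_empty]
    · push Not at h
      simp [h]
  rw [this]
  exact (measurableSet_candidates_eq D s V hN hf t ∅).compl.inter <|
    MeasurableSet.iInter fun u => MeasurableSet.iInter fun _ =>
      measurableSet_candidates_eq D s V hN hf u ∅

lemma measurableSet_select (hf : ∀ h, Measurable (f h)) (tie : Set (Fin s.m) → Fin s.m)
    (i : Fin s.m) : MeasurableSet {r : RoundTape s.m X H | select D f s V r tie = some i} := by
  have : {r : RoundTape s.m X H | select D f s V r tie = some i}
      = ⋃ t, ⋃ (A : Set (Fin s.m)), ⋃ (_ : tie A = i),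
        {r | selectRound D f s V r = some t} ∩ {r | candidates D f s V r t = A} := by
    ext r; simp [select]
  rw [this]
  exact MeasurableSet.iUnion fun t => MeasurableSet.iUnion fun A => MeasurableSet.iUnion fun _ =>
    (measurableSet_selectRound D s V hN hf t).inter (measurableSet_candidates_eq D s V hN hf t A)

/-- Step k+1 reads only the version space of step k and the tape entry k; the finitely many previous
version spaces and selected indices are enumerated. -/
lemma measurableSet_run (hf : ∀ h, Measurable (f h)) (tie : Set (Fin s.m) → Fin s.m) (ε : ℝ)
    (hstar : H) (k : ℕ) (W : Set H) :
    MeasurableSet[past (RoundTape s.m X H) k] {ω | run D f s tie ε hstar ω k = some W} := by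
  induction k generalizing W with
  | zero => simp only [run]; exact MeasurableSet.const _
  | succ k ih =>
    have : {ω | run D f s tie ε hstar ω (k + 1) = some W}
        = ⋃ U : Set H, ⋃ i : Fin s.m, {ω | run D f s tie ε hstar ω k = some U} ∩
          (fun ω : ℕ → RoundTape s.m X H => ω k) ⁻¹' ({r | Continues D f s U r ε} ∩
            {r | select D f s U r tie = some i} ∩
            {r | {h ∈ U | f h (r.1 i) = f hstar (r.1 i)} = W}) := by
      ext ω
      simp [run, Option.bind_eq_some_iff, and_assoc]
    rw [this]
    refine MeasurableSet.iUnion fun U => MeasurableSet.iUnion fun i =>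
      (past_mono k.le_succ _ (ih U)).inter (comap_eval_le_past k.lt_succ_self _ ⟨_, ?_, rfl⟩)
    refine ((measurableSet_continues D s U ε).inter
      (measurableSet_select D s U hN hf tie i)).inter ?_
    exact MeasurableSet.preimage
      (measurableSet_labels hf fun l => {h ∈ U | l h = l hstar} = W)
      ((measurable_pi_apply i).comp measurable_fst)

end Measurability

/-! ### One round of DBAL -/

lemma measureReal_prod_le {A B : Type*} [MeasurableSpace A] [MeasurableSpace B] (μ : Measure A)
    (ν : Measure B) [IsProbabilityMeasure μ] [IsProbabilityMeasure ν] {E : Set (A × B)}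
    (hE : MeasurableSet E) {c : ℝ} (hc : 0 ≤ c) (h : ∀ a, ν.real (Prod.mk a ⁻¹' E) ≤ c) :
    (μ.prod ν).real E ≤ c := by
  refine ENNReal.toReal_le_of_le_ofReal hc ?_
  rw [Measure.prod_apply hE]
  refine (lintegral_mono fun a => ?_).trans (by simp : ∫⁻ _, ENNReal.ofReal c ∂μ ≤ _)
  exact (ENNReal.le_ofReal_iff_toReal_le (measure_ne_top _ _) hc).2 (h a)

section Round

variable {X H : Type*} [MeasurableSpace X] [MeasurableSpace H] [Finite H]
  [MeasurableSingletonClass H] (D : Measure X) [IsProbabilityMeasure D] {f : H → X → Bool}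
  (prior : Measure H) [IsProbabilityMeasure prior] (s : SampleSizes) (V : Set H)

/-- At a fixed V only the V-entries of a stream are read. Projecting the product measure to them
leaves i.i.d. pairs, still independent of the unlabeled points. -/
lemma measurePreserving_points_draws (g : Stage) :
    MeasurePreserving (fun r : RoundTape s.m X H => (r.1, draws s V r g))
      (roundLaw s.m D prior)
      ((Measure.pi fun _ : Fin s.m => D).prod (Measure.infinitePi fun _ : ℕ =>
        pairLaw prior V)) := by
  refine (MeasurePreserving.id _).prod
    (g := fun (e : Stage → ℕ → Set H → H × H) i => e g i V) ?_
  have h1 := measurePreserving_eval_infinitePi (fun _ : Stage => Measure.infinitePi fun _ : ℕ =>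
    Measure.infinitePi fun V : Set H => pairLaw prior V) g
  have h2 : MeasurePreserving (fun (e : ℕ → Set H → H × H) i => e i V)
      (Measure.infinitePi fun _ : ℕ => Measure.infinitePi fun V : Set H => pairLaw prior V)
      (Measure.infinitePi fun _ : ℕ => pairLaw prior V) := by
    refine ⟨by fun_prop, ?_⟩
    rw [Measure.infinitePi_map_pi (f := fun _ (e : Set H → H × H) => e V)
      _ (fun _ => measurable_pi_apply V)]
    simp only [Measure.infinitePi_map_eval (fun V : Set H => pairLaw prior V) V]
  exact h2.comp h1

lemma measurePreserving_draws (g : Stage) :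
    MeasurePreserving (fun r : RoundTape s.m X H => draws s V r g) (roundLaw s.m D prior)
      (Measure.infinitePi fun _ : ℕ => pairLaw prior V) :=
  measurePreserving_snd.comp (measurePreserving_points_draws D prior s V g)

lemma measureReal_draws_le {E : Set (ℕ → H × H)} (hE : MeasurableSet E) (g : Stage) {c : ℝ}
    (h : (Measure.infinitePi fun _ : ℕ => pairLaw prior V).real E ≤ c) :
    (roundLaw s.m D prior).real {r : RoundTape s.m X H | draws s V r g ∈ E} ≤ c :=
  ((measurePreserving_draws D prior s V g).measureReal_preimage hE.nullMeasurableSet).trans_le h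

/-- No point of the sample splits `V`. -/
lemma measureReal_forall_not_avgSplits_le (hf : ∀ h, Measurable (f h)) {ρ τ : ℝ}
    (hτ : τ ≤ D.real {x | AvgSplits D f prior ρ V x}) :
    (roundLaw s.m D prior).real {r : RoundTape s.m X H | ∀ i, ¬ AvgSplits D f prior ρ V (r.1 i)}
      ≤ (1 - τ) ^ s.m := by
  have hm := measurableSet_avgSplits D hf prior ρ V
  have h1 : {r : RoundTape s.m X H | ∀ i, ¬ AvgSplits D f prior ρ V (r.1 i)}
      = Prod.fst ⁻¹' (Set.univ.pi fun _ : Fin s.m => {x | AvgSplits D f prior ρ V x}ᶜ) := by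
    ext r; simp
  have h2 : MeasurePreserving (Prod.fst : RoundTape s.m X H → _) (roundLaw s.m D prior)
      (Measure.pi fun _ : Fin s.m => D) := measurePreserving_fst
  rw [h1, h2.measureReal_preimage (MeasurableSet.univ_pi fun _ => hm.compl).nullMeasurableSet,
    measureReal_def, Measure.pi_pi, ENNReal.toReal_prod, Finset.prod_const, Finset.card_univ,
    Fintype.card_fin]
  refine pow_le_pow_left₀ ENNReal.toReal_nonneg ?_ _
  change D.real _ ≤ _
  rw [measureReal_compl hm, probReal_univ]
  linarith

/-- The accuracy to which SELECT estimates in its round `t`. -/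
def accuracy (t : ℕ) : ℝ := (1 / 2) ^ (t + 4)

lemma accuracy_nonneg (t : ℕ) : 0 ≤ accuracy t := by unfold accuracy; positivity

lemma accuracy_le_one (t : ℕ) : accuracy t ≤ 1 :=
  pow_le_one₀ (by norm_num) (by norm_num)

/-- The termination test is wrong in a round that starts with `V`. -/
def BadCheck (f : H → X → Bool) (ε : ℝ) (r : RoundTape s.m X H) : Prop :=
  prior V ≠ 0 ∧ ¬ ((avgDiam D f prior V ≤ ε / 2 → ¬ Continues D f s V r ε) ∧
    (¬ Continues D f s V r ε → avgDiam D f prior V ≤ ε))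

/-- The sample has a point that splits `V`, and the estimates in the rounds `t ≤ T` of SELECT
are accurate. -/
def GoodEstimates (f : H → X → Bool) (ρ : ℝ) (T : ℕ) (r : RoundTape s.m X H) : Prop :=
  (∃ i, AvgSplits D f prior ρ V (r.1 i)) ∧ ∀ t ≤ T,
    |phiHat D f s V r t - avgDiam D f prior V| ≤ accuracy t * avgDiam D f prior V ∧
    ∀ i b, |psiAt D f (s.est t) (draws s V r (.test t)) (r.1 i) b / s.est t
        - pairMass D f prior (labelPart f V (r.1 i) b) / prior.real V ^ 2|
      ≤ accuracy t * avgDiam D f prior V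

/-- SELECT may fail in a round that starts with a version space `V` of large diameter. -/
def BadSelect (f : H → X → Bool) (ε ρ : ℝ) (T : ℕ) (r : RoundTape s.m X H) : Prop :=
  prior V ≠ 0 ∧ ε / 2 < avgDiam D f prior V ∧ ¬ GoodEstimates D prior s V f ρ T r

lemma measureReal_badCheck_le {ε β : ℝ} (hε : 0 < ε)
    (hn : Real.exp (-(s.n * ε / 64)) ≤ β) :
    (roundLaw s.m D prior).real {r | BadCheck D prior s V f ε r} ≤ β := by
  have hβ : 0 ≤ β := (Real.exp_pos _).le.trans hn
  by_cases hV : prior V = 0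
  · simp [BadCheck, hV, hβ]
  have hn' : (0 : ℝ) < s.n := by exact_mod_cast s.n_pos
  have hmean := integral_hdist_pairLaw D f prior hV
  have hZ : Measurable fun q : H × H => hdist D f q.1 q.2 := .of_discrete
  have hZ0 : ∀ q : H × H, 0 ≤ hdist D f q.1 q.2 := fun q => hdist_nonneg D f _ _
  have hZ1 : ∀ q : H × H, hdist D f q.1 q.2 ≤ 1 := fun q => hdist_le_one D f _ _
  -- Below ε/2 the average must exceed its mean by ε/4, half of ε/2. Above ε it must fall short by a
  -- quarter of Φ(V). In between either outcome is allowed. The second failure gives the weaker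
  -- exponent nε/64.
  rcases le_or_gt (avgDiam D f prior V) (ε / 2) with h | h
  · have key := measureReal_sum_ge_le (pairLaw prior V) hZ hZ0 hZ1 (φ := ε / 2) (η := 1 / 2)
      (by rw [hmean]; exact h) (by norm_num) (by norm_num) s.n
    replace key := measureReal_draws_le D prior s V (measurableSet_le measurable_const
      (measurable_psi D (f := f) s.n)) .check key
    refine (measureReal_mono ?_).trans (key.trans ((Real.exp_le_exp.2 ?_).trans hn))
    · rintro r ⟨-, hr⟩
      have hc : Continues D f s V r ε := by
        by_contra hc
        exact hr ⟨fun _ => hc, fun _ => by linarith⟩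
      rw [Continues, le_div_iff₀' hn'] at hc
      refine le_trans ?_ hc
      rw [hmean]
      gcongr
      linarith
    · nlinarith
  rcases le_or_gt (avgDiam D f prior V) ε with h' | h'
  · have : {r | BadCheck D prior s V f ε r} = ∅ := by
      ext r; simp [BadCheck, h, h']
    simp [this, hβ]
  · have key := measureReal_sum_le_le (pairLaw prior V) hZ hZ0 hZ1 (φ := avgDiam D f prior V)
      (η := 1 / 4) hmean.le (by norm_num) (by norm_num) s.n
    replace key := measureReal_draws_le D prior s V (measurableSet_le
      (measurable_psi D (f := f) s.n) measurable_const) .check key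
    refine (measureReal_mono ?_).trans (key.trans ((Real.exp_le_exp.2 ?_).trans hn))
    · rintro r ⟨-, hr⟩
      have hc : ¬ Continues D f s V r ε := by
        intro hc
        exact hr ⟨fun h3 => absurd h (not_lt.2 h3), fun h3 => absurd hc h3⟩
      rw [Continues, not_le, div_lt_iff₀' hn'] at hc
      refine hc.le.trans ?_
      rw [hmean]
      gcongr
      linarith
    · nlinarith

lemma measureReal_badSelect_le (hf : ∀ h, Measurable (f h)) {ε ρ τ β : ℝ} {T : ℕ}
    (hτ1 : τ ≤ 1) (hτ : HasAvgSplittingIndex D f prior Set.univ ρ (ε / 2) τ)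
    (hβ : ∀ t ≤ T, Real.exp (-(s.est t * (ε / 2) * accuracy t ^ 2 / 4)) ≤ β) :
    (roundLaw s.m D prior).real {r | BadSelect D prior s V f ε ρ T r}
      ≤ (1 - τ) ^ s.m + (T + 1) * ((2 + 4 * s.m) * β) := by
  have hβ0 : 0 ≤ β := (Real.exp_pos _).le.trans (hβ 0 (Nat.zero_le _))
  have hnn : 0 ≤ (1 - τ) ^ s.m + (T + 1) * ((2 + 4 * s.m) * β) :=
    add_nonneg (pow_nonneg (by linarith) _) (by positivity)
  by_cases hV : prior V = 0
  · simpa [BadSelect, hV] using hnn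
  rcases le_or_gt (avgDiam D f prior V) (ε / 2) with hφ | hφ
  · simpa [BadSelect, not_lt.2 hφ] using hnn
  set φ := avgDiam D f prior V with hφdef
  have hexp : ∀ t ≤ T, Real.exp (-(s.est t * φ * accuracy t ^ 2 / 4)) ≤ β := fun t ht => by
    refine (Real.exp_le_exp.2 ?_).trans (hβ t ht)
    have : (s.est t : ℝ) * (ε / 2) * accuracy t ^ 2 ≤ s.est t * φ * accuracy t ^ 2 := by
      gcongr
    linarith
  let P : Set (RoundTape s.m X H) := {r | ∀ i, ¬ AvgSplits D f prior ρ V (r.1 i)}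
  let A : ℕ → Set (RoundTape s.m X H) := fun t => {r | accuracy t * φ < |phiHat D f s V r t - φ|}
  let B : ℕ → Fin s.m → Bool → Set (RoundTape s.m X H) := fun t i b =>
    {r | accuracy t * φ < |psiAt D f (s.est t) (draws s V r (.test t)) (r.1 i) b / s.est t
        - pairMass D f prior (labelPart f V (r.1 i) b) / prior.real V ^ 2|}
  have hsub : {r | BadSelect D prior s V f ε ρ T r}
      ⊆ P ∪ ⋃ t ∈ Finset.range (T + 1), (A t ∪ ⋃ i, ⋃ b, B t i b) := by
    rintro r ⟨-, -, hr⟩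
    by_contra hcon
    simp only [Set.mem_union, Set.mem_iUnion, not_or, not_exists, Finset.mem_range,
      Nat.lt_succ_iff] at hcon
    refine hr ⟨?_, fun t ht => ⟨not_lt.1 (hcon.2 t ht).1, fun i b =>
      not_lt.1 ((hcon.2 t ht).2 i b)⟩⟩
    by_contra h
    push Not at h
    exact hcon.1 h
  have hA : ∀ t ≤ T, (roundLaw s.m D prior).real (A t) ≤ 2 * β := fun t ht => by
    have key := measureReal_lt_abs_mean_sub_le (pairLaw prior V)
      (Z := fun q : H × H => hdist D f q.1 q.2) .of_discrete
      (fun q => hdist_nonneg D f _ _) (fun q => hdist_le_one D f _ _) (φ := φ)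
      (integral_hdist_pairLaw D f prior hV).le (accuracy_nonneg t) (accuracy_le_one t)
      (s.est_pos t)
    rw [integral_hdist_pairLaw D f prior hV] at key
    replace key := measureReal_draws_le D prior s V (measurableSet_lt measurable_const
      (((measurable_psi D (f := f) _).div_const _).sub_const _).abs) (.est t) key
    exact key.trans (by linarith [hexp t ht])
  have hB : ∀ t ≤ T, ∀ i b, (roundLaw s.m D prior).real (B t i b) ≤ 2 * β := fun t ht i b => by
    let E : Set ((Fin s.m → X) × (ℕ → H × H)) :=
      {q | accuracy t * φ < |psiAt D f (s.est t) q.2 (q.1 i) b / s.est t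
        - pairMass D f prior (labelPart f V (q.1 i) b) / prior.real V ^ 2|}
    have hlab : Measurable fun x : X =>
        pairMass D f prior (labelPart f V x b) / prior.real V ^ 2 :=
      (Measurable.of_discrete (f := fun l : H → Bool =>
        pairMass D f prior {h ∈ V | l h = b} / prior.real V ^ 2)).comp
        (measurable_pi_lambda (fun x h => f h x) hf)
    have hE : MeasurableSet E := by
      have hi : Measurable fun q : (Fin s.m → X) × (ℕ → H × H) => q.1 i :=
        (measurable_pi_apply i).comp measurable_fst
      exact measurableSet_lt measurable_const
        (((((measurable_psiAt D hf (s.est t) b).comp (hi.prodMk measurable_snd)).div_const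
          _).sub (hlab.comp hi)).abs)
    change (roundLaw s.m D prior).real
      ((fun r : RoundTape s.m X H => (r.1, draws s V r (.test t))) ⁻¹' E) ≤ _
    rw [(measurePreserving_points_draws D prior s V (.test t)).measureReal_preimage
      hE.nullMeasurableSet]
    -- With the unlabeled points frozen, the summands are a fixed function of i.i.d. pairs.
    refine measureReal_prod_le _ _ hE (by positivity) fun x => ?_
    have key := measureReal_lt_abs_mean_sub_le (pairLaw prior V)
      (Z := agreeDist D f (x i) b) .of_discrete
      (agreeDist_nonneg D f _ _) (agreeDist_le_one D f _ _) (φ := φ)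
      (integral_agreeDist_le D f prior hV (x i) b) (accuracy_nonneg t) (accuracy_le_one t)
      (s.est_pos t)
    rw [integral_agreeDist_pairLaw D f prior hV] at key
    exact key.trans (by linarith [hexp t ht])
  refine (measureReal_mono hsub).trans ((measureReal_union_le _ _).trans (add_le_add ?_ ?_))
  · exact measureReal_forall_not_avgSplits_le D prior s V hf (hτ V (Set.subset_univ _) hφ)
  · refine (measureReal_biUnion_finset_le _ _).trans ((Finset.sum_le_card_nsmul _ _
      ((2 + 4 * s.m) * β) fun t ht => ?_).trans (by simp))
    have ht : t ≤ T := by simpa [Nat.lt_succ_iff] using ht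
    refine (measureReal_union_le _ _).trans ?_
    have h1 : (roundLaw s.m D prior).real (⋃ i, ⋃ b, B t i b) ≤ s.m * (4 * β) := by
      refine (measureReal_iUnion_fintype_le _).trans ((Finset.sum_le_card_nsmul _ _ (4 * β)
        fun i _ => ?_).trans (by simp))
      refine (measureReal_iUnion_fintype_le _).trans ?_
      rw [Fintype.sum_bool]
      linarith [hB t ht i true, hB t ht i false]
    linarith [hA t ht]

variable {D prior s V}

/-- At round T the threshold ρ̂_T is at most ρ/2, so a true splitting point passes despite the
errors and SELECT halts by then. At every t ≤ T, ρ̂_t is at least ρ/4, so whatever passes really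
contracts the potential. -/
lemma exists_selectRound_of_goodEstimates {ρ : ℝ} {T : ℕ} {r : RoundTape s.m X H}
    (hs : ∀ t a, s.test t a = s.est t) (hT : (1 / 2 : ℝ) ^ (T + 1) ≤ ρ / 2)
    (hT' : ρ / 2 ≤ (1 / 2 : ℝ) ^ T) (hr : GoodEstimates D prior s V f ρ T r) :
    ∃ t ≤ T, selectRound D f s V r = some t ∧ (candidates D f s V r t).Nonempty ∧
      ∀ i ∈ candidates D f s V r t, ∀ b,
        pairMass D f prior (labelPart f V (r.1 i) b)
          ≤ (1 - 3 * ρ / 16) * pairMass D f prior V := by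
  classical
  set φ := avgDiam D f prior V with hφ
  have hφ0 : 0 ≤ φ := avgDiam_nonneg D f prior V
  obtain ⟨⟨i, hi⟩, hest⟩ := hr
  have hacc : ∀ t, accuracy t = (1 / 2 : ℝ) ^ (t + 1) / 8 := fun t => by
    rw [accuracy, pow_add, pow_add]; norm_num; ring
  have hcand : ∀ t j, j ∈ candidates D f s V r t ↔ ∀ b,
      psiAt D f (s.est t) (draws s V r (.test t)) (r.1 j) b / s.est t
        ≤ (1 - (1 / 2) ^ (t + 1)) * phiHat D f s V r t := fun t j => by
    have hpos : (0 : ℝ) ≤ s.est t := Nat.cast_nonneg _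
    simp only [candidates, testSize, hs, Set.mem_ofPred_eq, ← max_div_div_right hpos, max_le_iff,
      Bool.forall_bool]
    exact and_comm
  have hne : (candidates D f s V r T).Nonempty := by
    refine ⟨i, (hcand T i).2 fun b => ?_⟩
    obtain ⟨h1, h2⟩ := hest T le_rfl
    have h1 := (abs_le.1 h1).1
    have h2 := (abs_le.1 (h2 i b)).2
    have h3 := (avgSplits_iff D f prior ρ V (r.1 i)).1 hi b
    rw [hacc] at h1 h2
    have h4 : (0 : ℝ) < (1 / 2) ^ (T + 1) := by positivity
    have h5 : (1 / 2 : ℝ) ^ (T + 1) ≤ 1 := pow_le_one₀ (by norm_num) (by norm_num)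
    set q := (1 / 2 : ℝ) ^ (T + 1)
    -- Since ρ ≥ 2q, the splitting point scores at most (1 - 2q + q/8)φ, which is below the least
    -- possible threshold (1 - q)(1 - q/8)φ.
    have h6 : (1 - q) * ((1 - q / 8) * φ) ≤ (1 - q) * phiHat D f s V r T :=
      mul_le_mul_of_nonneg_left (by linarith) (by linarith)
    have h7 : 0 ≤ q ^ 2 * φ := by positivity
    have h8 : q * φ ≤ ρ / 2 * φ := mul_le_mul_of_nonneg_right hT hφ0
    nlinarith
  have hex : ∃ t, (candidates D f s V r t).Nonempty := ⟨T, hne⟩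
  have htT : Nat.find hex ≤ T := Nat.find_min' hex hne
  refine ⟨Nat.find hex, htT, by rw [selectRound, dif_pos hex], Nat.find_spec hex,
    fun j hj b => ?_⟩
  set t := Nat.find hex
  obtain ⟨h1, h2⟩ := hest t htT
  have h1 := (abs_le.1 h1).2
  have h2 := (abs_le.1 (h2 j b)).1
  have h3 := (hcand t j).1 hj b
  rw [hacc] at h1 h2
  have h4 : (0 : ℝ) < (1 / 2) ^ (t + 1) := by positivity
  have h5 : (1 / 2 : ℝ) ^ (t + 1) ≤ 1 := pow_le_one₀ (by norm_num) (by norm_num)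
  have h9 : ρ / 4 ≤ (1 / 2 : ℝ) ^ (t + 1) := by
    have : (1 / 2 : ℝ) ^ (T + 1) ≤ (1 / 2) ^ (t + 1) :=
      pow_le_pow_of_le_one (by norm_num) (by norm_num) (by omega)
    rw [pow_succ] at this
    linarith
  set q := (1 / 2 : ℝ) ^ (t + 1)
  have h6 : (1 - q) * phiHat D f s V r t ≤ (1 - q) * ((1 + q / 8) * φ) :=
    mul_le_mul_of_nonneg_left (by linarith) (by linarith)
  have h7 : 0 ≤ q ^ 2 * φ := by positivity
  have h8 : ρ / 4 * φ ≤ q * φ := mul_le_mul_of_nonneg_right h9 hφ0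
  -- The true value is at most ((1 - q)(1 + q/8) + q/8)φ ≤ (1 - 3q/4)φ, and q ≥ ρ/4 gives the
  -- constant 3/16.
  have h10 : pairMass D f prior (labelPart f V (r.1 j) b) / prior.real V ^ 2
      ≤ (1 - 3 * ρ / 16) * φ := by nlinarith
  rcases eq_or_ne (prior.real V) 0 with hV | hV
  · have hz : prior V = 0 := by simpa [measureReal_def, ENNReal.toReal_eq_zero_iff] using hV
    have hz' : prior (labelPart f V (r.1 j) b) = 0 := measure_mono_null (fun h hh => hh.1) hz
    simp [pairMass, Measure.restrict_eq_zero.2 hz, Measure.restrict_eq_zero.2 hz']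
  · rw [div_le_iff₀ (by positivity), mul_assoc, mul_comm φ, sq_mul_avgDiam] at h10
    exact h10

lemma selectCost_le {T t : ℕ} {r : RoundTape s.m X H} (hs : ∀ t a, s.test t a = s.est t)
    (ht : t ≤ T) (h : selectRound D f s V r = some t) :
    selectCost D f s V r ≤ ∑ u ∈ Finset.range (T + 1), 4 * s.est u := by
  rw [selectCost, h]
  refine (Finset.sum_le_sum_of_subset (Finset.range_mono (by omega))).trans
    (Finset.sum_le_sum fun u _ => ?_)
  rw [testSize, hs]; omega

end Round

/-! ### The run of DBAL on a good input -/

section Run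

variable {X H : Type*} [MeasurableSpace X] [MeasurableSpace H] [Finite H]
  [MeasurableSingletonClass H] {D : Measure X} [IsProbabilityMeasure D] {f : H → X → Bool}
  {prior : Measure H} [IsProbabilityMeasure prior] {s : SampleSizes}
  {tie : Set (Fin s.m) → Fin s.m} {ε ρ : ℝ} {hstar : H} {ω : ℕ → RoundTape s.m X H} {K T : ℕ}

lemma prior_ne_zero_of_mem {V : Set H} (hp : 0 < prior.real {hstar}) (hV : hstar ∈ V) :
    prior V ≠ 0 := fun h => by
  have : prior {hstar} = 0 := measure_mono_null (Set.singleton_subset_iff.2 hV) h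
  simp [measureReal_def, this] at hp

/-- Each query replaces V by one of its two label parts, the one containing the target, and the
selected point contracts the potential of both. -/
lemma run_mem_and_pairMass_le (hs : ∀ t a, s.test t a = s.est t)
    (hT : (1 / 2 : ℝ) ^ (T + 1) ≤ ρ / 2) (hT' : ρ / 2 ≤ (1 / 2 : ℝ) ^ T) (hρ : ρ ≤ 1)
    (hp : 0 < prior.real {hstar}) (htie : ∀ A : Set (Fin s.m), A.Nonempty → tie A ∈ A)
    (hcheck : ∀ k ≤ K, ∀ V, run D f s tie ε hstar ω k = some V →
      ¬ BadCheck D prior s V f ε (ω k))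
    (hsel : ∀ k < K, ∀ V, run D f s tie ε hstar ω k = some V →
      ¬ BadSelect D prior s V f ε ρ T (ω k)) :
    ∀ k ≤ K, ∀ V, run D f s tie ε hstar ω k = some V →
      hstar ∈ V ∧ pairMass D f prior V ≤ (1 - 3 * ρ / 16) ^ k := by
  intro k
  induction k with
  | zero =>
    intro _ V hV
    obtain rfl : Set.univ = V := by simpa [run] using hV
    exact ⟨Set.mem_univ _, by simpa using pairMass_univ_le_one D f prior⟩
  | succ k ih =>
    intro hk V hV
    simp only [run, Option.bind_eq_some_iff] at hV
    obtain ⟨U, hU, hV⟩ := hV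
    split_ifs at hV with hc
    simp only [select, Option.map_eq_some_iff] at hV
    obtain ⟨i, ⟨t, ht, rfl⟩, rfl⟩ := hV
    obtain ⟨hmem, hmass⟩ := ih (by omega) U hU
    refine ⟨⟨hmem, rfl⟩, ?_⟩
    have hU0 := prior_ne_zero_of_mem hp hmem
    have hlarge : ε / 2 < avgDiam D f prior U := by
      by_contra h
      exact hcheck k (by omega) U hU ⟨hU0, fun h' => h'.1 (not_lt.1 h) hc⟩
    have hgood : GoodEstimates D prior s U f ρ T (ω k) := by
      by_contra h
      exact hsel k (by omega) U hU ⟨hU0, hlarge, h⟩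
    obtain ⟨t', -, ht', hne, hall⟩ := exists_selectRound_of_goodEstimates hs hT hT' hgood
    obtain rfl : t' = t := Option.some_injective _ (ht'.symm.trans ht)
    refine (hall _ (htie _ hne) _).trans ?_
    rw [pow_succ']
    exact mul_le_mul_of_nonneg_left hmass (by linarith)

lemma exists_returns (hs : ∀ t a, s.test t a = s.est t)
    (hT : (1 / 2 : ℝ) ^ (T + 1) ≤ ρ / 2) (hT' : ρ / 2 ≤ (1 / 2 : ℝ) ^ T) (hρ : ρ ≤ 1)
    (hp : 0 < prior.real {hstar}) (htie : ∀ A : Set (Fin s.m), A.Nonempty → tie A ∈ A)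
    (hK : (1 - 3 * ρ / 16) ^ K ≤ prior.real {hstar} ^ 2 * (ε / 2))
    (hcheck : ∀ k ≤ K, ∀ V, run D f s tie ε hstar ω k = some V →
      ¬ BadCheck D prior s V f ε (ω k))
    (hsel : ∀ k < K, ∀ V, run D f s tie ε hstar ω k = some V →
      ¬ BadSelect D prior s V f ε ρ T (ω k)) :
    ∃ (k : ℕ) (V : Set H), k ≤ K ∧ Returns D f s tie ε hstar ω k V ∧
      avgDiam D f prior V ≤ ε ∧ ∀ j ≤ k, ∀ W : Set H, run D f s tie ε hstar ω j = some W →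
        roundCost D f s W (ω j) ε ≤ 2 * s.n + ∑ u ∈ Finset.range (T + 1), 4 * s.est u := by
  have hinv := run_mem_and_pairMass_le hs hT hT' hρ hp htie hcheck hsel
  have hcont : ∀ k ≤ K, ∀ V, run D f s tie ε hstar ω k = some V → Continues D f s V (ω k) ε →
      k < K ∧ ∃ t ≤ T, selectRound D f s V (ω k) = some t := by
    intro k hk V hV hc
    obtain ⟨hmem, hmass⟩ := hinv k hk V hV
    have hV0 := prior_ne_zero_of_mem hp hmem
    have hlarge : ε / 2 < avgDiam D f prior V := by
      by_contra h
      exact hcheck k hk V hV ⟨hV0, fun h' => h'.1 (not_lt.1 h) hc⟩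
    -- After K queries the potential is at most p²ε/2 ≤ π(V)²ε/2, so Φ(V) ≤ ε/2 and a correct test
    -- must stop.
    have hkK : k < K := by
      refine lt_of_le_of_ne hk ?_
      rintro rfl
      refine not_le.2 hlarge ?_
      have hle : prior.real {hstar} ≤ prior.real V :=
        measureReal_mono (Set.singleton_subset_iff.2 hmem)
      rw [avgDiam_eq, div_le_iff₀ (by have := hp.trans_le hle; positivity)]
      -- The sign of ε is forced by `hK`, whose left side is nonnegative.
      have h0 : 0 ≤ ε / 2 := by
        by_contra hneg
        have h1 : (0 : ℝ) ≤ (1 - 3 * ρ / 16) ^ k := pow_nonneg (by linarith) _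
        have h2 : prior.real {hstar} ^ 2 * (ε / 2) < 0 :=
          mul_neg_of_pos_of_neg (by positivity) (not_le.1 hneg)
        linarith
      calc pairMass D f prior V ≤ prior.real {hstar} ^ 2 * (ε / 2) := hmass.trans hK
        _ ≤ ε / 2 * prior.real V ^ 2 := by
          rw [mul_comm]; gcongr
    have hgood : GoodEstimates D prior s V f ρ T (ω k) := by
      by_contra h
      exact hsel k hkK V hV ⟨hV0, hlarge, h⟩
    obtain ⟨t, ht, h, -⟩ := exists_selectRound_of_goodEstimates hs hT hT' hgood
    exact ⟨hkK, t, ht, h⟩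
  have hret : ∃ k ≤ K, ∃ V, Returns D f s tie ε hstar ω k V := by
    by_contra hno
    have hall : ∀ k ≤ K, ∃ V, run D f s tie ε hstar ω k = some V := by
      intro k
      induction k with
      | zero => exact fun _ => ⟨_, rfl⟩
      | succ k ih =>
        intro hk
        obtain ⟨V, hV⟩ := ih (by omega)
        have hc : Continues D f s V (ω k) ε := by
          by_contra hc
          exact hno ⟨k, by omega, V, hV, hc⟩
        obtain ⟨-, t, -, ht⟩ := hcont k (by omega) V hV hc
        simp [run, hV, hc, select, ht]
    obtain ⟨V, hV⟩ := hall K le_rfl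
    refine hno ⟨K, le_rfl, V, hV, fun hc => ?_⟩
    exact lt_irrefl _ (hcont K le_rfl V hV hc).1
  obtain ⟨k, hk, V, hV⟩ := hret
  refine ⟨k, V, hk, hV, ?_, fun j hj W hW => ?_⟩
  · by_contra h
    exact hcheck k hk V hV.1 ⟨prior_ne_zero_of_mem hp (hinv k hk V hV.1).1,
      fun h' => h (h'.2 hV.2)⟩
  · rw [roundCost]
    split_ifs with hc
    · obtain ⟨-, t, ht, h⟩ := hcont j (hj.trans hk) W hW hc
      exact Nat.add_le_add_left (selectCost_le hs ht h) _
    · omega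

lemma law_not_le (hf : ∀ h, Measurable (f h)) (hs : ∀ t a, s.test t a = s.est t)
    (good : (ℕ → RoundTape s.m X H) → Prop) {β γ : ℝ} (hβ : 0 ≤ β) (hγ : 0 ≤ γ)
    (hcheck : ∀ V, (roundLaw s.m D prior).real {r | BadCheck D prior s V f ε r} ≤ β)
    (hsel : ∀ V, (roundLaw s.m D prior).real {r | BadSelect D prior s V f ε ρ T r} ≤ γ)
    (hgood : ∀ ω,
      (∀ k ≤ K, ∀ V, run D f s tie ε hstar ω k = some V → ¬ BadCheck D prior s V f ε (ω k)) →
      (∀ k < K, ∀ V, run D f s tie ε hstar ω k = some V →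
        ¬ BadSelect D prior s V f ε ρ T (ω k)) → good ω) :
    law s.m D prior {ω | ¬ good ω} ≤ ENNReal.ofReal ((K + 1) * β + K * γ) := by
  have hsub : {ω | ¬ good ω} ⊆
      (⋃ k ∈ Finset.range (K + 1), {ω | ∃ V, run D f s tie ε hstar ω k = some V ∧
        ω k ∈ {r | BadCheck D prior s V f ε r}}) ∪
      ⋃ k ∈ Finset.range K, {ω | ∃ V, run D f s tie ε hstar ω k = some V ∧
        ω k ∈ {r | BadSelect D prior s V f ε ρ T r}} := by
    intro ω hω
    by_contra h
    simp only [Set.mem_union, Set.mem_iUnion, Finset.mem_range, Set.mem_ofPred_eq, not_or,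
      not_exists, not_and, Nat.lt_succ_iff] at h
    exact hω (hgood ω h.1 h.2)
  have hbound : ∀ {B : Set H → Set (RoundTape s.m X H)} {c : ℝ}, 0 ≤ c →
      (∀ V, (roundLaw s.m D prior).real (B V) ≤ c) → ∀ k,
      law s.m D prior {ω | ∃ V, run D f s tie ε hstar ω k = some V ∧ ω k ∈ B V}
        ≤ ENNReal.ofReal c := fun {B c} hc hB k =>
    measure_adaptive_le _ (measurableSet_run D s hs hf tie ε hstar k) fun V =>
      (ENNReal.le_ofReal_iff_toReal_le (measure_ne_top _ _) hc).2 (hB V)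
  refine (measure_mono hsub).trans ((measure_union_le _ _).trans ?_)
  rw [ENNReal.ofReal_add (by positivity) (by positivity)]
  refine add_le_add ((measure_biUnion_finset_le _ _).trans ?_)
    ((measure_biUnion_finset_le _ _).trans ?_)
  · refine (Finset.sum_le_sum fun k _ => hbound hβ hcheck k).trans (le_of_eq ?_)
    rw [Finset.sum_const, Finset.card_range, ← ENNReal.ofReal_nsmul, nsmul_eq_mul]
    push_cast; rfl
  · refine (Finset.sum_le_sum fun k _ => hbound hγ hsel k).trans (le_of_eq ?_)
    rw [Finset.sum_const, Finset.card_range, ← ENNReal.ofReal_nsmul, nsmul_eq_mul]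

end Run

/-! ### The sample sizes -/

lemma exists_rounds {ρ ε p : ℝ} (hρ : 0 < ρ) (hρ1 : ρ ≤ 1) (hε : 0 < ε) (hε1 : ε < 1)
    (hp : 0 < p) (hp1 : p ≤ 1) :
    ∃ K : ℕ, (K : ℝ) ≤ 8 / ρ * (Real.log (2 / ε) + 2 * Real.log (1 / p)) ∧ 5 ≤ K ∧
      2 / ρ ≤ K ∧ (1 - 3 * ρ / 16) ^ K ≤ p ^ 2 * (ε / 2) := by
  set A := Real.log (2 / ε) + 2 * Real.log (1 / p) with hA
  have hA2 : 0.693 ≤ A := by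
    have h1 : Real.log 2 ≤ Real.log (2 / ε) :=
      Real.log_le_log (by norm_num) (by rw [le_div_iff₀ hε]; linarith)
    have h2 : 0 ≤ Real.log (1 / p) := Real.log_nonneg (by rw [le_div_iff₀ hp]; linarith)
    have := Real.log_two_gt_d9
    linarith
  have hnn : 0 ≤ 8 / ρ * A := by positivity
  have hfl := Nat.lt_floor_add_one (8 / ρ * A)
  -- Rounding down, to respect the stated bound, costs less than ρ in Kρ. Since A ≥ log 2, (3/16)(8A
  -- - ρ) still exceeds A, and K ≥ 5 and K ≥ 2/ρ also follow.
  set K := ⌊8 / ρ * A⌋₊ with hKdef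
  have hK : 8 * A < (K + 1) * ρ := by
    rw [div_mul_eq_mul_div, div_lt_iff₀ hρ] at hfl
    exact hfl
  have hK0 : (0 : ℝ) ≤ K := Nat.cast_nonneg _
  refine ⟨K, Nat.floor_le hnn, ?_, ?_, ?_⟩
  · refine Nat.le_floor ?_
    rw [div_mul_eq_mul_div, le_div_iff₀ hρ]
    push_cast; nlinarith
  · rw [div_le_iff₀ hρ]; nlinarith
  · have hexp : p ^ 2 * (ε / 2) = Real.exp (-A) := by
      rw [← Real.exp_log (show 0 < p ^ 2 * (ε / 2) by positivity),
        Real.log_mul (by positivity) (by positivity), Real.log_pow, hA, one_div, Real.log_inv,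
        ← inv_div ε 2, Real.log_inv]
      push_cast; congr 1; ring
    rw [hexp]
    calc (1 - 3 * ρ / 16) ^ K ≤ Real.exp (-(3 * ρ / 16)) ^ K :=
          pow_le_pow_left₀ (by linarith) (Real.one_sub_le_exp_neg _) _
      _ = Real.exp (-(K * (3 * ρ / 16))) := by rw [← Real.exp_nat_mul]; congr 1; ring
      _ ≤ Real.exp (-A) := Real.exp_le_exp.2 (by nlinarith)

lemma log_one_sub_le {x : ℝ} (h0 : 0 ≤ x) (h1 : x < 1) :
    Real.log (1 - x) ≤ -(x + x ^ 2 / 2 + x ^ 3 / 3) := by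
  have h := Real.hasSum_pow_div_log_of_abs_lt_one (x := x) (by rwa [abs_of_nonneg h0])
  have := sum_le_hasSum (Finset.range 3) (fun i _ => by positivity) h
  simp only [Finset.sum_range_succ, Finset.sum_range_zero] at this
  norm_num at this
  linarith

/-- Here too the bound on m forces rounding down, so 1 - τ ≤ e^{-τ} alone is too weak. The higher
terms of log(1 - τ) recover the lost τ. Up to τ near 1 this needs the cubic term when only A ≥ 9/4
is known. -/
lemma exists_sampleSize {τ A : ℝ} (hτ : 0 < τ) (hτ1 : τ ≤ 1) (hA : 9 / 4 ≤ A) :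
    ∃ m : ℕ, 0 < m ∧ (m : ℝ) ≤ 1 / τ * A ∧ (1 - τ) ^ m ≤ Real.exp (-A) := by
  have hnn : 0 ≤ 1 / τ * A := by positivity
  have hpos : 0 < ⌊1 / τ * A⌋₊ := by
    refine Nat.floor_pos.2 ?_
    rw [one_div_mul_eq_div, le_div_iff₀ hτ]; linarith
  refine ⟨_, hpos, Nat.floor_le hnn, ?_⟩
  have hfl := Nat.lt_floor_add_one (1 / τ * A)
  set m := ⌊1 / τ * A⌋₊
  rcases hτ1.eq_or_lt with rfl | hlt
  · rw [sub_self, zero_pow hpos.ne']; exact (Real.exp_pos _).le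
  have hm : A - τ ≤ m * τ := by
    rw [one_div_mul_eq_div, div_lt_iff₀ hτ] at hfl; linarith
  rw [← Real.exp_log (show 0 < 1 - τ by linarith), ← Real.exp_nat_mul, Real.exp_le_exp]
  have hl := log_one_sub_le hτ.le hlt
  calc (m : ℝ) * Real.log (1 - τ) ≤ m * (-(τ + τ ^ 2 / 2 + τ ^ 3 / 3)) :=
        mul_le_mul_of_nonneg_left hl (Nat.cast_nonneg _)
    _ = -((m * τ) * (1 + τ / 2 + τ ^ 2 / 3)) := by ring
    _ ≤ -((A - τ) * (1 + τ / 2 + τ ^ 2 / 3)) :=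
        neg_le_neg (mul_le_mul_of_nonneg_right hm (by positivity))
    _ ≤ -A := by
        have h1 : 9 / 4 * (τ * (1 / 2 + τ / 3)) ≤ A * (τ * (1 / 2 + τ / 3)) :=
          mul_le_mul_of_nonneg_right hA (by positivity)
        have h2 : 0 ≤ τ * (1 - τ) * (3 + 8 * τ) := by
          have : 0 ≤ 1 - τ := by linarith
          positivity
        nlinarith

lemma log_ten_ge : 9 / 4 ≤ Real.log 10 := by
  have h : Real.log (2 ^ 13) ≤ Real.log (10 ^ 4) :=
    Real.log_le_log (by norm_num) (by norm_num)
  rw [Real.log_pow, Real.log_pow] at h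
  have := Real.log_two_gt_d9
  push_cast at h
  linarith

lemma exists_selectRounds {ρ : ℝ} (hρ : 0 < ρ) (hρ1 : ρ ≤ 1) :
    ∃ T : ℕ, (1 / 2 : ℝ) ^ (T + 1) ≤ ρ / 2 ∧ ρ / 2 ≤ (1 / 2 : ℝ) ^ T ∧ (2 : ℝ) ^ T ≤ 2 / ρ := by
  obtain ⟨T, h1, h2⟩ := exists_nat_pow_near_of_lt_one (x := ρ / 2) (y := (1 / 2 : ℝ))
    (by linarith) (by linarith) (by norm_num) (by norm_num)
  refine ⟨T, h1.le, h2, ?_⟩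
  rw [one_div, inv_pow, le_inv_comm₀ (by linarith) (by positivity)] at h2
  rwa [inv_div] at h2

/-- The sample sizes for which the bounds are proved; `L` is the logarithm in the bound. -/
def sizes (ε L : ℝ) (m : ℕ) (hm : 0 < m) (hε : 0 < ε) (hL : 0 < L) : SampleSizes where
  m := m
  -- The constants 256 and 32 make each Chernoff exponent at least 4L, so for L = log(mK/δ) each
  -- tail factor is at most (δ/(mK))⁴.
  n := ⌈256 * L / ε⌉₊
  est t := ⌈32 * L * 4 ^ (t + 4) / ε⌉₊
  -- The estimate of Φ(V) can be ignored: accuracy is required only when Φ(V) > ε/2, and this lower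
  -- bound already determines a sufficient size.
  test t _ := ⌈32 * L * 4 ^ (t + 4) / ε⌉₊
  m_pos := hm
  n_pos := Nat.ceil_pos.2 (by positivity)
  est_pos _ := Nat.ceil_pos.2 (by positivity)
  test_pos _ _ := Nat.ceil_pos.2 (by positivity)

section Sizes

variable {ε L : ℝ} {m : ℕ} (hm : 0 < m) (hε : 0 < ε) (hL : 0 < L)

lemma exp_n_sizes_le :
    Real.exp (-((sizes ε L m hm hε hL).n * ε / 64)) ≤ Real.exp (-(4 * L)) := by
  rw [Real.exp_le_exp, neg_le_neg_iff]
  have := Nat.le_ceil (256 * L / ε)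
  rw [div_le_iff₀ hε] at this
  simp only [sizes]
  linarith

lemma exp_est_sizes_le (t : ℕ) :
    Real.exp (-((sizes ε L m hm hε hL).est t * (ε / 2) * accuracy t ^ 2 / 4))
      ≤ Real.exp (-(4 * L)) := by
  rw [Real.exp_le_exp, neg_le_neg_iff]
  have h := Nat.le_ceil (32 * L * 4 ^ (t + 4) / ε)
  rw [div_le_iff₀ hε] at h
  have hq : accuracy t ^ 2 * 4 ^ (t + 4) = 1 := by
    rw [accuracy, ← pow_mul, mul_comm (t + 4), pow_mul, ← mul_pow]; norm_num
  have h2 := mul_le_mul_of_nonneg_right h (sq_nonneg (accuracy t))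
  rw [mul_assoc, mul_comm (4 ^ (t + 4)), hq] at h2
  simp only [sizes]
  linarith

/-- The sizes grow like 4^t, so the sum is governed by 4^T ≤ 4/ρ². The ceilings are absorbed by L/ε
≥ 1. -/
lemma cost_sizes_le {ρ : ℝ} {T : ℕ} (hε1 : ε < 1) (hL1 : 1 ≤ L) (hρ : 0 < ρ) (hρ1 : ρ ≤ 1)
    (hT : (2 : ℝ) ^ T ≤ 2 / ρ) :
    ((2 * (sizes ε L m hm hε hL).n + ∑ u ∈ Finset.range (T + 1),
      4 * (sizes ε L m hm hε hL).est u : ℕ) : ℝ) ≤ 200000 * (1 / (ε * ρ ^ 2) * L) := by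
  have h1 : 1 ≤ L / ε := by rw [le_div_iff₀ hε]; linarith
  have hn : ((sizes ε L m hm hε hL).n : ℝ) ≤ 257 * (L / ε) := by
    have := Nat.ceil_lt_add_one (show 0 ≤ 256 * L / ε by positivity)
    rw [mul_div_assoc] at this
    simp only [sizes, mul_div_assoc]
    linarith
  have hest : ∀ u, ((sizes ε L m hm hε hL).est u : ℝ) ≤ 8193 * (L / ε) * 4 ^ u := fun u => by
    have := Nat.ceil_lt_add_one (show 0 ≤ 32 * L * 4 ^ (u + 4) / ε by positivity)
    have h4 : (1 : ℝ) ≤ 4 ^ u := one_le_pow₀ (by norm_num)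
    have h5 : 32 * L * 4 ^ (u + 4) / ε = 8192 * (L / ε) * 4 ^ u := by rw [pow_add]; ring
    have h6 : 1 ≤ L / ε * 4 ^ u := one_le_mul_of_one_le_of_one_le h1 h4
    simp only [sizes]
    linarith
  have hgeom : ∑ u ∈ Finset.range (T + 1), (4 : ℝ) ^ u ≤ 16 / 3 * (1 / ρ ^ 2) := by
    rw [geom_sum_eq (by norm_num)]
    have h4 : (4 : ℝ) ^ T ≤ 4 * (1 / ρ ^ 2) := by
      calc (4 : ℝ) ^ T = (2 ^ T) ^ 2 := by rw [← pow_mul, mul_comm, pow_mul]; norm_num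
        _ ≤ (2 / ρ) ^ 2 := pow_le_pow_left₀ (by positivity) hT 2
        _ = _ := by rw [div_pow]; ring
    rw [pow_succ]
    linarith
  have hsum : ∑ u ∈ Finset.range (T + 1), 4 * ((sizes ε L m hm hε hL).est u : ℝ)
      ≤ 32772 * (L / ε) * (16 / 3 * (1 / ρ ^ 2)) := by
    refine (Finset.sum_le_sum fun u _ => mul_le_mul_of_nonneg_left (hest u)
      (by norm_num : (0 : ℝ) ≤ 4)).trans ?_
    rw [← Finset.mul_sum, ← Finset.mul_sum]
    have := mul_le_mul_of_nonneg_left hgeom (show 0 ≤ 32772 * (L / ε) by positivity)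
    linarith
  have hr : 1 ≤ 1 / ρ ^ 2 := by
    rw [le_div_iff₀ (by positivity), one_mul]
    exact pow_le_one₀ hρ.le hρ1
  have h7 : L / ε ≤ L / ε * (1 / ρ ^ 2) := le_mul_of_one_le_right (by positivity) hr
  have h8 : 1 / (ε * ρ ^ 2) * L = L / ε * (1 / ρ ^ 2) := by field_simp
  push_cast
  rw [h8]
  linarith

end Sizes

/-- Missing a splitting point takes δ/2 over all rounds. With M = mK the estimation errors total at
most 7M²β ≤ 7δ/25, because β = (δ/M)⁴ and M ≥ 5. -/
lemma failure_le {δ β : ℝ} {m K T : ℕ} (hδ : 0 < δ) (hδ1 : δ < 1) (hm : 0 < m) (hK : 5 ≤ K)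
    (hT : (T : ℝ) + 1 ≤ K) (hβ : β = (δ / (m * K)) ^ 4) :
    (K + 1) * β + K * (δ / (2 * K) + (T + 1) * ((2 + 4 * m) * β)) ≤ δ := by
  have hm1 : (1 : ℝ) ≤ m := by exact_mod_cast hm
  have hK5 : (5 : ℝ) ≤ K := by exact_mod_cast hK
  have hβ0 : 0 ≤ β := by rw [hβ]; positivity
  set M : ℝ := m * K
  have hMK : (K : ℝ) ≤ M := le_mul_of_one_le_left (by positivity) hm1
  have hM : 5 ≤ M := hK5.trans hMK
  have hMβ : M ^ 2 * β ≤ δ / 25 := by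
    have h1 : M ^ 2 * β = δ * δ ^ 3 * (1 / M ^ 2) := by rw [hβ]; field_simp
    have h2 : 1 / M ^ 2 ≤ 1 / 25 := one_div_le_one_div_of_le (by norm_num) (by nlinarith)
    have h3 : δ * δ ^ 3 ≤ δ := mul_le_of_le_one_right hδ.le (pow_le_one₀ hδ.le hδ1.le)
    rw [h1]
    calc δ * δ ^ 3 * (1 / M ^ 2) ≤ δ * (1 / 25) := by gcongr
      _ = δ / 25 := by ring
  have h4 : (K + 1) * β ≤ M ^ 2 * β := by gcongr; nlinarith
  have h5 : K * ((T + 1) * ((2 + 4 * m) * β)) ≤ 6 * (M ^ 2 * β) := by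
    calc (K : ℝ) * ((T + 1) * ((2 + 4 * m) * β)) ≤ K * (K * ((6 * m ^ 2) * β)) := by
          gcongr; nlinarith
      _ = 6 * (M ^ 2 * β) := by simp only [M]; ring
  have h6 : (K : ℝ) * (δ / (2 * K)) = δ / 2 := by field_simp
  rw [mul_add, h6]
  linarith

end DBAL

end

/-! ### Choice of the parameters and conclusion. -/

theorem mainTheorem1 :
    ∃ C : ℝ, 0 < C ∧
      ∀ ρ ε τ δ p : ℝ, 0 < ρ → ρ ≤ 1 → 0 < ε → ε < 1 → 0 < τ → τ ≤ 1 → 0 < δ → δ < 1 →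
        0 < p → p ≤ 1 →
      ∃ (K : ℕ) (s : DBAL.SampleSizes),
        (K : ℝ) ≤ 8 / ρ * (Real.log (2 / ε) + 2 * Real.log (1 / p)) ∧
        (s.m : ℝ) ≤ 1 / τ * Real.log (2 * K / δ) ∧
        ∀ (X : Type*) [MeasurableSpace X] (D : Measure X) [IsProbabilityMeasure D]
          (H : Type*) [Finite H] [MeasurableSpace H] [MeasurableSingletonClass H]
          (f : H → X → Bool) (_ : ∀ h, Measurable (f h))
          (prior : Measure H) [IsProbabilityMeasure prior]
          (hstar : H) (_ : prior.real {hstar} = p)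
          (tie : Set (Fin s.m) → Fin s.m) (_ : ∀ A : Set (Fin s.m), A.Nonempty → tie A ∈ A),
          DBAL.HasAvgSplittingIndex D f prior Set.univ ρ (ε / 2) τ →
          DBAL.law s.m D prior
            {ω | ¬ ∃ (k : ℕ) (V : Set H),
              k ≤ K ∧
              DBAL.Returns D f s tie ε hstar ω k V ∧
              DBAL.avgDiam D f prior V ≤ ε ∧
              ∀ j ≤ k, ∀ W : Set H, DBAL.run D f s tie ε hstar ω j = some W →
                (DBAL.roundCost D f s W (ω j) ε : ℝ) ≤
                  C * ((1 / (ε * ρ ^ 2) + Real.log (1 / ρ) / ε ^ 2) *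
                    (Real.log (s.m * K / δ) + Real.posLog (Real.log (1 / ε))))}
            ≤ ENNReal.ofReal δ := by
  refine ⟨200000, by norm_num, ?_⟩
  intro ρ ε τ δ p hρ hρ1 hε hε1 hτ hτ1 hδ hδ1 hp hp1
  obtain ⟨K, hKle, hK5, hKρ, hKpow⟩ := DBAL.exists_rounds hρ hρ1 hε hε1 hp hp1
  obtain ⟨T, hT, hT', hT2⟩ := DBAL.exists_selectRounds hρ hρ1
  have hK5' : (5 : ℝ) ≤ K := by exact_mod_cast hK5
  have hA : 9 / 4 ≤ Real.log (2 * K / δ) :=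
    DBAL.log_ten_ge.trans (Real.log_le_log (by norm_num) (by rw [le_div_iff₀ hδ]; nlinarith))
  obtain ⟨m, hm, hmle, hmpow⟩ := DBAL.exists_sampleSize hτ hτ1 hA
  have hm1 : (1 : ℝ) ≤ m := by exact_mod_cast hm
  have hmK : (5 : ℝ) ≤ m * K := by nlinarith
  have hmKδ : (5 : ℝ) ≤ m * K / δ := by rw [le_div_iff₀ hδ]; nlinarith
  have hL1 : 1 ≤ Real.log (m * K / δ) := by
    rw [Real.le_log_iff_exp_le (by positivity)]
    linarith [Real.exp_one_lt_d9]
  have hL : 0 < Real.log (m * K / δ) := by linarith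
  refine ⟨K, DBAL.sizes ε (Real.log (m * K / δ)) m hm hε hL, hKle, hmle, ?_⟩
  set s := DBAL.sizes ε (Real.log (m * K / δ)) m hm hε hL
  intro X _ D _ H _ _ _ f hf prior _ hstar hprior tie htie hind
  have hsm : s.m = m := rfl
  set β := Real.exp (-(4 * Real.log (m * K / δ)))
  have hβ : β = (δ / (m * K)) ^ 4 := by
    rw [← inv_div, ← Real.exp_log (show 0 < ((m * K / δ)⁻¹ : ℝ) by positivity), Real.log_inv,
      ← Real.exp_nat_mul]
    simp only [β]
    congr 1; push_cast; ring
  have hβ0 : 0 ≤ β := (Real.exp_pos _).le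
  have hexp : Real.exp (-Real.log (2 * K / δ)) = δ / (2 * K) := by
    rw [← Real.log_inv, Real.exp_log (by positivity), inv_div]
  -- By T + 1 ≤ 2^T ≤ 2/ρ ≤ K, the union bound over the rounds of SELECT is paid for by log(mK/δ).
  have hTK : (T : ℝ) + 1 ≤ K := by
    have : (T : ℝ) + 1 ≤ 2 ^ T := by exact_mod_cast T.lt_two_pow_self
    linarith
  have hp' : 0 < prior.real {hstar} := by rw [hprior]; exact hp
  refine (DBAL.law_not_le (K := K) (T := T) (β := β) (ρ := ρ)
    (γ := δ / (2 * K) + (T + 1) * ((2 + 4 * m) * β)) (ε := ε) (tie := tie) (hstar := hstar)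
    hf (fun _ _ => rfl) _ hβ0 (by positivity) (fun V => ?_) (fun V => ?_)
    (fun ω h1 h2 => ?_)).trans
    (ENNReal.ofReal_le_ofReal (DBAL.failure_le hδ hδ1 hm hK5 hTK hβ))
  · exact DBAL.measureReal_badCheck_le D prior s V hε (DBAL.exp_n_sizes_le hm hε hL)
  · refine (DBAL.measureReal_badSelect_le D prior s V hf hτ1 hind
      fun t _ => DBAL.exp_est_sizes_le hm hε hL t).trans ?_
    rw [hsm, ← hexp]
    gcongr
  · obtain ⟨k, V, hk, hV, hΦ, hcost⟩ := DBAL.exists_returns (fun _ _ => rfl) hT hT' hρ1 hp' htie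
      (by rw [hprior]; exact hKpow) h1 h2
    refine ⟨k, V, hk, hV, hΦ, fun j hj W hW => ?_⟩
    refine (Nat.cast_le.2 (hcost j hj W hW)).trans
      ((DBAL.cost_sizes_le hm hε hL hε1 hL1 hρ hρ1 hT2).trans ?_)
    -- The cost is already below C log(mK/δ)/(ερ²); the other terms of the stated bound only enlarge
    -- it.
    have h3 : 0 ≤ Real.log (1 / ρ) / ε ^ 2 :=
      div_nonneg (Real.log_nonneg (by rw [le_div_iff₀ hρ]; linarith)) (by positivity)
    have h4 : 0 ≤ Real.posLog (Real.log (1 / ε)) := Real.posLog_nonneg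
    have h5 : 0 ≤ 1 / (ε * ρ ^ 2) := by positivity
    refine mul_le_mul_of_nonneg_left (mul_le_mul (by linarith) ?_ hL.le (by linarith))
      (by norm_num)
    rw [hsm]
    linarith
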